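/- Let $K$ be a field. For a nonzero proper graded ideal $I$ of a standard graded polynomial ring $S=K[x_1,\dots,x_N]$, let $\operatorname{Ass}(I)$ be the set of associated primes of $S/I$, let $\alpha(I)=\min\{d: I_d\neq 0\}$, for $\mathfrak p\in\operatorname{Ass}(I)$ let $\mathrm v_{\mathfrak p}(I)$ be the least degree of a homogeneous $f\in S$ with $I:f=\mathfrak p$, and let $\mathrm v(I)=\min_{\mathfrak p\in\operatorname{Ass}(I)}\mathrm v_{\mathfrak p}(I)$. Let $\operatorname{astab}(I)$ be the least $k_0\ge 1$ such that $\operatorname{Ass}(I^k)=\operatorname{Ass}(I^{k_0})$ for all $k\ge k_0$, and let $\operatorname{vstab}(I)$ be the least $k_0\ge 1$ such that, for some constant $c\in\mathbb Z$, $\mathrm v(I^k)=\alpha(I)k+c$ for all $k\ge k_0$. **Theorem.** For all integers $a,b\ge 1$ there are $N>0$ and a nonzero proper monomial ideal $I\subset K[x_1,\dots,x_N]$ with $(\operatorname{astab}(I),\operatorname{vstab}(I))=(a,b)$. For $a\ge 2$ one can take the following monomial ideal of the polynomial ring $K[x_0,x_1,\dots,x_{3a},x,y]$ in $3(a+1)$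 variables: $$I=x_0^{2b-1}J+(x^{2b+1},\,x^2y^{2b-1},\,y^{2b+1}),\qquad J=\sum_{i=1}^{a-1}(x_{3i-2}x_{3i-1},\,x_{3i-2}x_{3i},\,x_{3i-1}x_{3i}).$$ In particular $\operatorname{astab}$ and $\operatorname{vstab}$ are not comparable in general: over every field $K$ there are nonzero proper monomial ideals $I$ with $\operatorname{astab}(I)<\operatorname{vstab}(I)$ and others with $\operatorname{vstab}(I)<\operatorname{astab}(I)$. -/

import Mathlib

open MvPolynomial

namespace StabilityIndices

/-- A monomial ideal of `K[x_i : i ∈ σ]`: an ideal generated by monomials. -/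
def IsMonomialIdeal {σ K : Type*} [Field K] (I : Ideal (MvPolynomial σ K)) : Prop :=
  ∃ A : Set (σ →₀ ℕ), I = Ideal.span ((fun m => monomial m (1 : K)) '' A)

/-- The initial degree `α(I) = min {d : I_d ≠ 0}`, the least degree of a nonzero homogeneous
element of `I` (meaningful for nonzero graded ideals). -/
noncomputable def initialDegree {σ K : Type*} [Field K] (I : Ideal (MvPolynomial σ K)) : ℕ :=
  sInf {d : ℕ | ∃ f ∈ I, f ≠ 0 ∧ f.IsHomogeneous d}

/-- The `v_p`-number of `I`: the least degree of a homogeneous `f` with `I : f = p`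
(meaningful for `I` graded and `p ∈ Ass(I)`). -/
noncomputable def vNumberAt {σ K : Type*} [Field K] (I p : Ideal (MvPolynomial σ K)) : ℕ :=
  sInf {d : ℕ | ∃ f : MvPolynomial σ K, f.IsHomogeneous d ∧ Submodule.colon I {f} = p}

/-- The `v`-number `v(I) = min {v_p(I) : p ∈ Ass(I)}` (meaningful for proper graded ideals). -/
noncomputable def vNumber {σ K : Type*} [Field K] (I : Ideal (MvPolynomial σ K)) : ℕ :=
  sInf (vNumberAt I '' Submodule.associatedPrimes I)

/-- The index of ass-stability: the least `k₀ ≥ 1` with `Ass(I^k) = Ass(I^k₀)` for all `k ≥ k₀`.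
If there were no such `k₀`, the value would be `0`. -/
noncomputable def astab {σ K : Type*} [Field K] (I : Ideal (MvPolynomial σ K)) : ℕ :=
  sInf {k₀ : ℕ | 1 ≤ k₀ ∧ ∀ k : ℕ, k₀ ≤ k →
    Submodule.associatedPrimes (I ^ k) = Submodule.associatedPrimes (I ^ k₀)}

/-- The index of `v`-stability: the least `k₀ ≥ 1` such that, for some integer constant `c`,
`v(I^k) = α(I) k + c` for all `k ≥ k₀`. If there were no such `k₀`, the value would be `0`. -/
noncomputable def vstab {σ K : Type*} [Field K] (I : Ideal (MvPolynomial σ K)) : ℕ :=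
  sInf {k₀ : ℕ | 1 ≤ k₀ ∧ ∃ c : ℤ, ∀ k : ℕ, k₀ ≤ k →
    (vNumber (I ^ k) : ℤ) = (initialDegree I : ℤ) * (k : ℤ) + c}

/-- Index set of the variables `x_0, …, x_{3a}, x, y`: `Sum.inl i` stands for `x_i`,
`Sum.inr 0` for `x` and `Sum.inr 1` for `y`. -/
abbrev Vars (a : ℕ) : Type := Fin (3 * a + 1) ⊕ Fin 2

/-- The edge ideal of the `i`-th triangle, generated by the three products of two of the variables
`x_{3i+1}, x_{3i+2}, x_{3i+3}`, for `i = 0, …, a - 2`. -/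
noncomputable def triangleIdeal (K : Type*) [Field K] (a : ℕ) (i : Fin (a - 1)) :
    Ideal (MvPolynomial (Vars a) K) :=
  let u : MvPolynomial (Vars a) K := X (Sum.inl ⟨3 * (i : ℕ) + 1, by omega⟩)
  let v : MvPolynomial (Vars a) K := X (Sum.inl ⟨3 * (i : ℕ) + 2, by omega⟩)
  let w : MvPolynomial (Vars a) K := X (Sum.inl ⟨3 * (i : ℕ) + 3, by omega⟩)
  Ideal.span {u * v, u * w, v * w}

/-- The ideal `x_0^{2b-1} J + (x^{2b+1}, x^2 y^{2b-1}, y^{2b+1})` of `K[x_0, …, x_{3a}, x, y]`,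
where `J` is the sum of the `a - 1` triangle ideals. -/
noncomputable def mainIdeal (K : Type*) [Field K] (a b : ℕ) : Ideal (MvPolynomial (Vars a) K) :=
  let x₀ : MvPolynomial (Vars a) K := X (Sum.inl 0)
  let x : MvPolynomial (Vars a) K := X (Sum.inr 0)
  let y : MvPolynomial (Vars a) K := X (Sum.inr 1)
  Ideal.span {x₀ ^ (2 * b - 1)} * (∑ i : Fin (a - 1), triangleIdeal K a i) +
    Ideal.span {x ^ (2 * b + 1), x ^ 2 * y ^ (2 * b - 1), y ^ (2 * b + 1)}

end StabilityIndices

/-! Write `I = x₀^(2b-1) J + Q` with `Q = (x^(2b+1), x²y^(2b-1), y^(2b+1))` and `J` the edge ideal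
of `n = a - 1` disjoint triangles. For a monomial ideal, associated primes and v-numbers are
determined by witnesses, monomials `m` with `I^k : m = (variables in F)`. Since the three blocks
`x₀`, `{x, y}` and the vertices are disjoint, `m ∈ I^k` means that for some `i + j ≥ k` the plane
part lies in `Q^j`, the exponent of `x₀` is at least `(2b-1)i`, and the vertex part lies in `J^i`.
Everything follows from exchanging such pairs `(i, j)`.

Associated primes: `F` always contains `x` and `y`. If it contains `x₀`, then it contains no vertex
(`vertex_notMem_of_witness`); otherwise it contains at least two vertices of each triangle
(`edge_mem_of_witness`). All these candidates occur as soon as `k ≥ n + 1`, with the candidate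
containing `x₀` requiring `n > 0`. The prime with all vertices does not occur for `1 ≤ k ≤ n`: its
witness is divisible by an edge of every triangle, which already supplies `n` factors
(`lt_of_witness_of_vertices`). Hence `astab = n + 1 = a`.

v-numbers: all generators have degree `2b+1`. For `n > 0`, comparing the decompositions of `m·x` and
`m·z`, with `z` another variable of `F`, gives `deg m ≥ (2b+1)(k+1) - 2`. Equality forces a monomial
of degree `(2b+1)q - 1`, for some `q ≤ k`, that both `x` and `y` multiply into `Q^q`. Comparing
exponents of `x` shows that this needs `q ≥ b` (`PlanePow.le_of_socle_degree`), and for `k ≥ b`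
equality is attained (`isPlaneSocle_of_le`). For `n = 0` the bound is `(2b+1)k - 1`, again sharp
exactly when `k ≥ b`. Hence `vstab = b`. -/

namespace StabilityIndices

/-! ### Associated primes and v-numbers of monomial ideals through monomial witnesses -/

section MonomialIdeals

variable {σ K : Type*} [Field K]

theorem IsMonomialIdeal.mem_iff {I : Ideal (MvPolynomial σ K)} (hI : IsMonomialIdeal I)
    {f : MvPolynomial σ K} : f ∈ I ↔ ∀ m ∈ f.support, monomial m (1 : K) ∈ I := by
  classical
  obtain ⟨A, rfl⟩ := hI
  rw [mem_ideal_span_monomial_image]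
  refine forall₂_congr fun m _ => ?_
  rw [mem_ideal_span_monomial_image]
  simp [support_monomial]

theorem monomial_mem_of_le {I : Ideal (MvPolynomial σ K)} {m m' : σ →₀ ℕ} (h : m ≤ m')
    (hm : monomial m (1 : K) ∈ I) : monomial m' (1 : K) ∈ I := by
  obtain ⟨e, rfl⟩ := exists_add_of_le h
  rw [add_comm, ← one_mul (1 : K), ← monomial_mul]
  exact I.mul_mem_left _ hm

theorem monomial_one_mem_iff {I : Ideal (MvPolynomial σ K)} {m : σ →₀ ℕ} {c : K} (hc : c ≠ 0) :
    monomial m c ∈ I ↔ monomial m (1 : K) ∈ I := by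
  have key : ∀ a b : K, monomial m (a * b) = C a * monomial m b := fun a b => by
    rw [C_mul_monomial]
  constructor
  · intro h
    rw [← inv_mul_cancel₀ hc, key]
    exact I.mul_mem_left _ h
  · intro h
    rw [← mul_one c, key]
    exact I.mul_mem_left _ h

theorem support_sub_monomial_coeff [DecidableEq σ] (f : MvPolynomial σ K) (u : σ →₀ ℕ) :
    (f - monomial u (f.coeff u)).support = f.support.erase u := by
  ext w
  simp only [mem_support_iff, coeff_sub, coeff_monomial, Finset.mem_erase]
  by_cases h : u = w
  · subst h; simp
  · simp [h, Ne.symm h]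

theorem card_support_monomial_mul_le (u : σ →₀ ℕ) (f : MvPolynomial σ K) :
    (monomial u (1 : K) * f).support.card ≤ f.support.card := by
  classical
  refine (Finset.card_le_card (support_mul _ _)).trans ?_
  refine (Finset.card_add_le).trans ?_
  simp [support_monomial]

/-- A colon ideal of a monomial ideal by a single element is a monomial ideal as soon as it is
prime. -/
theorem monomial_mem_of_prime_colon [Finite σ] {I p : Ideal (MvPolynomial σ K)}
    (hI : IsMonomialIdeal I) (hp : p.IsPrime) (h : ∃ f : MvPolynomial σ K, Submodule.colon I {f} = p)
    {g : MvPolynomial σ K} (hg : g ∈ p) {u : σ →₀ ℕ} (hu : u ∈ g.support) :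
    monomial u (1 : K) ∈ p := by
  classical
  let _ : LinearOrder σ := LinearOrder.lift' (Finite.equivFin σ) (Finite.equivFin σ).injective
  let o : MonomialOrder σ := MonomialOrder.lex
  -- Among all `f` with colon ideal `p`, one with fewest terms is chosen.
  obtain ⟨f, hf, hmin⟩ : ∃ f : MvPolynomial σ K, Submodule.colon I {f} = p ∧
      ∀ f' : MvPolynomial σ K, Submodule.colon I {f'} = p → f.support.card ≤ f'.support.card := by
    have hne : ∃ n, ∃ f : MvPolynomial σ K, Submodule.colon I {f} = p ∧ f.support.card = n := by
      obtain ⟨f, hf⟩ := h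
      exact ⟨_, f, hf, rfl⟩
    obtain ⟨f, hf, hc⟩ := Nat.find_spec hne
    exact ⟨f, hf, fun f' hf' => hc ▸ Nat.find_min' hne ⟨f', hf', rfl⟩⟩
  have hf0 : f ≠ 0 := by
    rintro rfl
    apply hp.ne_top
    rw [← hf, Submodule.colon_singleton_zero]
  have memp : ∀ x, x ∈ p ↔ x * f ∈ I := fun x => by
    rw [← hf, Submodule.mem_colon_singleton, smul_eq_mul]
  induction hn : g.support.card using Nat.strong_induction_on generalizing g with
  | _ n ih =>
  have hg0 : g ≠ 0 := by rintro rfl; simp at hu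
  set d := o.degree g with hd
  have hdg : d ∈ g.support := o.degree_mem_support hg0
  have hlead : monomial d (1 : K) ∈ p := by
    -- The leading monomial of `g * f` lies in `I`. If `X^d ∉ p`, primality shows that `X^d` times
    -- `f` without its leading term still has colon ideal `p`, contradicting minimality. So the
    -- leading term of `g` can be stripped off and the induction continues.
    by_contra hnot
    have h1 : monomial (d + o.degree f) (1 : K) ∈ I := by
      apply hI.mem_iff.1 ((memp g).1 hg)
      rw [mem_support_iff, hd, o.coeff_mul_of_degree_add]
      exact mul_ne_zero (o.leadingCoeff_ne_zero_iff.2 hg0) (o.leadingCoeff_ne_zero_iff.2 hf0)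
    set f' := monomial d (1 : K) * (f - monomial (o.degree f) (f.coeff (o.degree f))) with hf'
    have h2 : Submodule.colon I {f'} = p := by
      ext x
      rw [Submodule.mem_colon_singleton, smul_eq_mul]
      have e : x * f' = x * monomial d (1 : K) * f -
          x * monomial (d + o.degree f) (f.coeff (o.degree f)) := by
        rw [hf', mul_sub, mul_sub, monomial_mul, one_mul, mul_assoc]
      have h3 : x * monomial (d + o.degree f) (f.coeff (o.degree f)) ∈ I :=
        I.mul_mem_left _ ((monomial_one_mem_iff (o.leadingCoeff_ne_zero_iff.2 hf0)).2 h1)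
      rw [e, Submodule.sub_mem_iff_left _ h3, ← memp]
      exact ⟨fun hx => (hp.mem_or_mem hx).resolve_right hnot, fun hx => p.mul_mem_right _ hx⟩
    have h4 := hmin f' h2
    have h5 := card_support_monomial_mul_le d (f - monomial (o.degree f) (f.coeff (o.degree f)))
    rw [← hf', support_sub_monomial_coeff, Finset.card_erase_of_mem (o.degree_mem_support hf0)] at h5
    have h6 : 0 < f.support.card := Finset.card_pos.2 ⟨_, o.degree_mem_support hf0⟩
    omega
  by_cases hud : u = d
  · rwa [hud]
  · have hsup := support_sub_monomial_coeff g d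
    refine ih (g.support.erase d).card ?_ (g := g - monomial d (g.coeff d)) ?_ ?_ (by rw [hsup])
    · rw [← hn]
      exact Finset.card_erase_lt_of_mem hdg
    · refine p.sub_mem hg ((monomial_one_mem_iff ?_).2 hlead)
      exact mem_support_iff.1 hdg
    · rw [hsup]
      exact Finset.mem_erase.2 ⟨hud, hu⟩

/-- As `p` is a monomial ideal, it annihilates each term of `f` modulo `I`; conversely, what
annihilates every term annihilates `f`. So `p` is a finite intersection of the colons by the terms,
and a prime equals one of them. -/
theorem exists_monomial_colon_eq [Finite σ] {I p : Ideal (MvPolynomial σ K)}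
    (hI : IsMonomialIdeal I) (hp : p.IsPrime) {f : MvPolynomial σ K}
    (hf : Submodule.colon I {f} = p) :
    ∃ m ∈ f.support, Submodule.colon I {monomial m (1 : K)} = p := by
  classical
  have hle : ∀ m ∈ f.support, p ≤ Submodule.colon I {monomial m (1 : K)} := by
    intro m hm g hg
    rw [g.as_sum]
    refine Ideal.sum_mem _ fun u hu => ?_
    rw [monomial_one_mem_iff (mem_support_iff.1 hu), Submodule.mem_colon_singleton, smul_eq_mul,
      monomial_mul, one_mul]
    have h1 : monomial u (1 : K) * f ∈ I := by
      have := monomial_mem_of_prime_colon hI hp ⟨f, hf⟩ hg hu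
      rwa [← hf, Submodule.mem_colon_singleton, smul_eq_mul] at this
    apply hI.mem_iff.1 h1
    rw [mem_support_iff, coeff_monomial_mul, one_mul]
    exact mem_support_iff.1 hm
  have hinf : f.support.inf (fun m => Submodule.colon I {monomial m (1 : K)}) ≤ p := by
    intro g hg
    rw [Submodule.mem_finsetInf] at hg
    rw [← hf, Submodule.mem_colon_singleton, smul_eq_mul, f.as_sum, Finset.mul_sum]
    refine Ideal.sum_mem _ fun m hm => ?_
    have := hg m hm
    rw [Submodule.mem_colon_singleton, smul_eq_mul] at this
    have e : monomial m (f.coeff m) = C (f.coeff m) * monomial m (1 : K) := by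
      rw [C_mul_monomial, mul_one]
    rw [e, mul_left_comm]
    exact I.mul_mem_left _ this
  obtain ⟨m, hm, h⟩ := (hp.inf_le').1 hinf
  exact ⟨m, hm, le_antisymm h (hle m hm)⟩

/-- The ideal generated by the variables in `F`. -/
noncomputable def varIdeal (K : Type*) [Field K] (F : Set σ) : Ideal (MvPolynomial σ K) :=
  Ideal.span (X '' F)

theorem mem_varIdeal {F : Set σ} {f : MvPolynomial σ K} :
    f ∈ varIdeal K F ↔ ∀ m ∈ f.support, ∃ i ∈ F, m i ≠ 0 :=
  mem_ideal_span_X_image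

theorem monomial_mem_varIdeal {F : Set σ} {m : σ →₀ ℕ} :
    monomial m (1 : K) ∈ varIdeal K F ↔ ∃ i ∈ F, m i ≠ 0 := by
  classical
  rw [mem_varIdeal]
  simp [support_monomial]

theorem X_mem_varIdeal {F : Set σ} {i : σ} : (X i : MvPolynomial σ K) ∈ varIdeal K F ↔ i ∈ F := by
  classical
  rw [X, monomial_mem_varIdeal]
  constructor
  · rintro ⟨j, hj, h⟩
    rw [Finsupp.single_apply] at h
    split_ifs at h with hij
    · rwa [hij]
    · exact absurd rfl h
  · exact fun h => ⟨i, h, by simp⟩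

theorem varIdeal_injective : Function.Injective (varIdeal (σ := σ) K) := fun F G h => by
  ext i
  rw [← X_mem_varIdeal (K := K), h, X_mem_varIdeal]

instance varIdeal_isPrime (F : Set σ) : (varIdeal K F).IsPrime := by
  classical
  let φ : MvPolynomial σ K →ₐ[K] MvPolynomial σ K := aeval fun i => if i ∈ F then 0 else X i
  have h : varIdeal K F = RingHom.ker φ := by
    apply le_antisymm
    · refine Ideal.span_le.2 ?_
      rintro _ ⟨i, hi, rfl⟩
      simp [φ, RingHom.mem_ker, hi]
    · intro f hf
      have e : (Ideal.Quotient.mkₐ K (varIdeal K F)).comp φ =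
          Ideal.Quotient.mkₐ K (varIdeal K F) := by
        refine algHom_ext fun i => ?_
        by_cases hi : i ∈ F
        · have := Ideal.Quotient.eq_zero_iff_mem.2 ((X_mem_varIdeal (K := K)).2 hi)
          simp [φ, hi, this]
        · simp [φ, hi]
      have e' := DFunLike.congr_fun e f
      rw [AlgHom.comp_apply, (RingHom.mem_ker (f := φ)).1 hf, map_zero] at e'
      exact Ideal.Quotient.eq_zero_iff_mem.1 e'.symm
  rw [h]
  exact RingHom.ker_isPrime φ

/-- The monomial with exponent `m` is a witness for the associated prime `(X_i : i ∈ F)` of the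
monomial ideal `I`, that is, `I : X^m = (X_i : i ∈ F)`. -/
def IsWitness (I : Ideal (MvPolynomial σ K)) (F : Set σ) (m : σ →₀ ℕ) : Prop :=
  ∀ e : σ →₀ ℕ, monomial (m + e) (1 : K) ∈ I ↔ ∃ i ∈ F, e i ≠ 0

theorem IsWitness.colon_eq {I : Ideal (MvPolynomial σ K)} (hI : IsMonomialIdeal I) {F : Set σ}
    {m : σ →₀ ℕ} (h : IsWitness I F m) :
    Submodule.colon I {monomial m (1 : K)} = varIdeal K F := by
  classical
  ext f
  rw [Submodule.mem_colon_singleton, smul_eq_mul, mem_varIdeal, mul_comm, hI.mem_iff]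
  constructor
  · intro hf u hu
    rw [← h u]
    apply hf
    rw [mem_support_iff, coeff_monomial_mul, one_mul]
    exact mem_support_iff.1 hu
  · intro hf u hu
    obtain ⟨a, ha, b, hb, rfl⟩ := Finset.mem_add.1 (support_mul _ _ hu)
    have : a = m := by simpa [support_monomial] using ha
    rw [this, h b]
    exact hf b hb

theorem exists_isWitness [Finite σ] {I p : Ideal (MvPolynomial σ K)}
    (hI : IsMonomialIdeal I) (hp : p.IsPrime) {f : MvPolynomial σ K}
    (hf : Submodule.colon I {f} = p) :
    ∃ m ∈ f.support, ∃ F, p = varIdeal K F ∧ IsWitness I F m := by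
  classical
  obtain ⟨m, hm, hmp⟩ := exists_monomial_colon_eq hI hp hf
  have key : ∀ e : σ →₀ ℕ, monomial e (1 : K) ∈ p ↔ ∃ i ∈ {i | X i ∈ p}, e i ≠ 0 := by
    intro e
    constructor
    · intro he
      rw [monomial_eq, C_1, one_mul, Finsupp.prod] at he
      obtain ⟨i, hi, h⟩ := (hp.prod_mem_iff).1 he
      exact ⟨i, hp.mem_of_pow_mem _ h, Finsupp.mem_support_iff.1 hi⟩
    · rintro ⟨i, hi, he⟩
      refine monomial_mem_of_le (m := Finsupp.single i 1) ?_ hi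
      rw [Finsupp.single_le_iff]
      omega
  have hpF : p = varIdeal K {i | X i ∈ p} := by
    apply le_antisymm
    · intro g hg
      rw [mem_varIdeal]
      exact fun u hu => (key u).1 (monomial_mem_of_prime_colon hI hp ⟨f, hf⟩ hg hu)
    · refine Ideal.span_le.2 ?_
      rintro _ ⟨i, hi, rfl⟩
      exact hi
  refine ⟨m, hm, _, hpF, fun e => ?_⟩
  rw [← key, ← hmp, Submodule.mem_colon_singleton, smul_eq_mul, monomial_mul, one_mul, add_comm]

theorem mem_associatedPrimes_iff [Finite σ] {I p : Ideal (MvPolynomial σ K)}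
    (hI : IsMonomialIdeal I) :
    p ∈ Submodule.associatedPrimes I ↔ ∃ F m, p = varIdeal K F ∧ IsWitness I F m := by
  rw [Submodule.AssociatePrimes.mem_iff, Submodule.isAssociatedPrime_iff]
  constructor
  · rintro ⟨hp, f, hf⟩
    obtain ⟨m, _, F, h⟩ := exists_isWitness hI hp hf.symm
    exact ⟨F, m, h⟩
  · rintro ⟨F, m, rfl, h⟩
    exact ⟨inferInstance, _, (h.colon_eq hI).symm⟩

theorem varIdeal_mem_associatedPrimes_iff [Finite σ] {I : Ideal (MvPolynomial σ K)} {F : Set σ}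
    (hI : IsMonomialIdeal I) :
    varIdeal K F ∈ Submodule.associatedPrimes I ↔ ∃ m, IsWitness I F m := by
  rw [mem_associatedPrimes_iff hI]
  constructor
  · rintro ⟨F', m, h, hw⟩
    rw [varIdeal_injective h]
    exact ⟨m, hw⟩
  · rintro ⟨m, hw⟩
    exact ⟨F, m, rfl, hw⟩

theorem IsWitness.vNumber_le [Finite σ] {I : Ideal (MvPolynomial σ K)} (hI : IsMonomialIdeal I)
    {F : Set σ} {m : σ →₀ ℕ} (h : IsWitness I F m) : vNumber I ≤ m.degree := by
  have h1 : vNumber I ≤ vNumberAt I (varIdeal K F) :=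
    Nat.sInf_le (Set.mem_image_of_mem _ ((varIdeal_mem_associatedPrimes_iff hI).2 ⟨m, h⟩))
  have h2 : vNumberAt I (varIdeal K F) ≤ m.degree := by
    apply Nat.sInf_le
    exact ⟨_, isHomogeneous_monomial _ rfl, h.colon_eq hI⟩
  exact h1.trans h2

/-- Lower bounds need only be checked on witnesses: a homogeneous `f` attaining the v-number has a
witness in its support, of the same degree. -/
theorem le_vNumber [Finite σ] {I : Ideal (MvPolynomial σ K)} (hI : IsMonomialIdeal I) {D : ℕ}
    (hne : ∃ F m, IsWitness I F m) (hD : ∀ F m, IsWitness I F m → D ≤ m.degree) :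
    D ≤ vNumber I := by
  obtain ⟨F₀, m₀, h₀⟩ := hne
  have hne : (vNumberAt I '' Submodule.associatedPrimes I).Nonempty :=
    ⟨_, varIdeal K F₀, (varIdeal_mem_associatedPrimes_iff hI).2 ⟨m₀, h₀⟩, rfl⟩
  obtain ⟨p, hp, hpv⟩ := Nat.sInf_mem hne
  rw [vNumber, ← hpv]
  obtain ⟨F, m, rfl, hw⟩ := (mem_associatedPrimes_iff hI).1 hp
  obtain ⟨f, hf, hfp⟩ := Nat.sInf_mem (s := {d : ℕ | ∃ f : MvPolynomial σ K,
    f.IsHomogeneous d ∧ Submodule.colon I {f} = varIdeal K F})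
    ⟨_, _, isHomogeneous_monomial _ rfl, hw.colon_eq hI⟩
  obtain ⟨m', hm', F', hF', hw'⟩ := exists_isWitness hI inferInstance hfp
  rw [vNumberAt, hf.degree_eq_sum_deg_support hm']
  exact hD F' m' hw'

end MonomialIdeals

/-! ### Powers of ideals generated by monomials -/

section Powers

variable {σ K : Type*} [Field K]

theorem isMonomialIdeal_span_range {ι : Type*} (g : ι → σ →₀ ℕ) :
    IsMonomialIdeal (Ideal.span (Set.range fun i => monomial (g i) (1 : K))) :=
  ⟨Set.range g, by rw [← Set.range_comp]; rfl⟩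

theorem span_monomial_pow {ι : Type*} [Fintype ι] (g : ι → σ →₀ ℕ) (k : ℕ) :
    Ideal.span (Set.range fun i => monomial (g i) (1 : K)) ^ k =
      Ideal.span ((fun m => monomial m (1 : K)) ''
        {e | ∃ c : ι → ℕ, ∑ i, c i = k ∧ e = ∑ i, c i • g i}) := by
  classical
  induction k with
  | zero =>
    rw [pow_zero, Ideal.one_eq_top, eq_comm, Ideal.eq_top_iff_one]
    exact Ideal.subset_span ⟨0, ⟨0, by simp, by simp⟩, rfl⟩
  | succ k ih =>
    rw [pow_succ, ih, Ideal.span_mul_span']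
    congr 1
    ext f
    constructor
    · rintro ⟨_, ⟨_, ⟨c, hc, rfl⟩, rfl⟩, _, ⟨i, rfl⟩, rfl⟩
      refine ⟨_, ⟨c + Pi.single i 1, ?_, rfl⟩, ?_⟩
      · simp [Finset.sum_add_distrib, hc]
      · simp only [Pi.add_apply, add_smul, Finset.sum_add_distrib, monomial_mul, one_mul]
        rw [Finset.sum_eq_single (a := i) (f := fun j => (Pi.single i 1 : ι → ℕ) j • g j)]
        · simp
        · intro j _ hj
          simp [Pi.single_eq_of_ne hj]
        · simp
    · rintro ⟨_, ⟨c, hc, rfl⟩, rfl⟩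
      obtain ⟨i, hi⟩ : ∃ i, c i ≠ 0 := by
        by_contra! h
        simp [h] at hc
      have hci : c = Function.update c i (c i - 1) + Pi.single i 1 := by
        ext j
        by_cases h : j = i
        · subst h; simp; omega
        · simp [h]
      have h1 : ∑ j, (Pi.single i 1 : ι → ℕ) j • g j = g i := by
        rw [Finset.sum_eq_single (a := i)]
        · simp
        · intro j _ hj
          simp [Pi.single_eq_of_ne hj]
        · simp
      refine ⟨_, ⟨_, ⟨Function.update c i (c i - 1), ?_, rfl⟩, rfl⟩, _, ⟨i, rfl⟩, ?_⟩
      · rw [hci] at hc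
        simp only [Pi.add_apply, Finset.sum_add_distrib] at hc
        simpa using hc
      · conv_rhs => rw [hci]
        simp only [Pi.add_apply, add_smul, Finset.sum_add_distrib, monomial_mul, one_mul, h1]

theorem monomial_mem_span_pow_iff {ι : Type*} [Fintype ι] (g : ι → σ →₀ ℕ) (k : ℕ)
    (m : σ →₀ ℕ) :
    monomial m (1 : K) ∈ Ideal.span (Set.range fun i => monomial (g i) (1 : K)) ^ k ↔
      ∃ c : ι → ℕ, ∑ i, c i = k ∧ ∑ i, c i • g i ≤ m := by
  classical
  rw [span_monomial_pow, mem_ideal_span_monomial_image]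
  simp [support_monomial]

theorem isMonomialIdeal_span_range_pow {ι : Type*} [Fintype ι] (g : ι → σ →₀ ℕ) (k : ℕ) :
    IsMonomialIdeal (Ideal.span (Set.range fun i => monomial (g i) (1 : K)) ^ k) :=
  ⟨_, span_monomial_pow g k⟩

end Powers

/-- `x^X y^Y` lies in `(x^(2b+1), x^2 y^(2b-1), y^(2b+1))^k`. -/
def PlanePow (b k X Y : ℕ) : Prop :=
  ∃ p q r, k ≤ p + q + r ∧ (2 * b + 1) * p + 2 * q ≤ X ∧ (2 * b - 1) * q + (2 * b + 1) * r ≤ Y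

/-- The monomial with exponent `τ` lies in the `s`-th power of the edge ideal of a triangle. -/
def TrianglePow (s : ℕ) (τ : Fin 3 → ℕ) : Prop :=
  -- `f l` is the multiplicity of the edge opposite to the vertex `l`.
  ∃ f : Fin 3 → ℕ, s ≤ f 0 + f 1 + f 2 ∧ f 1 + f 2 ≤ τ 0 ∧ f 0 + f 2 ≤ τ 1 ∧ f 0 + f 1 ≤ τ 2

/-- The monomial with exponent `τ` lies in the `i`-th power of the sum of the edge ideals of `n`
disjoint triangles. -/
def TrianglesPow {n : ℕ} (i : ℕ) (τ : Fin n → Fin 3 → ℕ) : Prop :=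
  ∃ s : Fin n → ℕ, i ≤ ∑ j, s j ∧ ∀ j, TrianglePow (s j) (τ j)

/-- The monomial with exponents `C` (for `x_0`), `X`, `Y` and `τ` lies in the `k`-th power of the
ideal `x_0^(2b-1) J + (x^(2b+1), x^2 y^(2b-1), y^(2b+1))`. -/
def MixedPow {n : ℕ} (b k C X Y : ℕ) (τ : Fin n → Fin 3 → ℕ) : Prop :=
  ∃ i j, k ≤ i + j ∧ PlanePow b j X Y ∧ (2 * b - 1) * i ≤ C ∧ TrianglesPow i τ

/-- Index set of the generators of the ideal; it also indexes the variables that occur. -/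
abbrev Gen (n : ℕ) : Type := Fin 3 ⊕ Fin n × Fin 3

/-! ### The ideal on abstract variables and membership in its powers -/

section GenIdeal

variable {n : ℕ} {σ : Type*}

/-- Exponents of the generators; `v (inl 0)`, `v (inl 1)`, `v (inl 2)` play the roles of `x_0`,
`x`, `y`, and `v (inr (j, l))` is the `l`-th vertex of the `j`-th triangle. -/
noncomputable def genExp (b : ℕ) (v : Gen n → σ) : Gen n → σ →₀ ℕ
  | Sum.inl 0 => Finsupp.single (v (Sum.inl 1)) (2 * b + 1)
  | Sum.inl 1 => Finsupp.single (v (Sum.inl 1)) 2 + Finsupp.single (v (Sum.inl 2)) (2 * b - 1)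
  | Sum.inl 2 => Finsupp.single (v (Sum.inl 2)) (2 * b + 1)
  | Sum.inr (j, l) => Finsupp.single (v (Sum.inl 0)) (2 * b - 1) +
      (Finsupp.single (v (Sum.inr (j, l + 1))) 1 + Finsupp.single (v (Sum.inr (j, l + 2))) 1)

/-- The ideal generated by the monomials with exponents `genExp b v`. -/
noncomputable def genIdeal (K : Type*) [Field K] (b : ℕ) (v : Gen n → σ) :
    Ideal (MvPolynomial σ K) :=
  Ideal.span (Set.range fun i => monomial (genExp b v i) (1 : K))

/-- Trims multiplicities: the membership predicates ask for at least `k` factors, while a product of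
generators in the `k`-th power has exactly `k`. -/
theorem exists_le_sum_eq {ι : Type*} [Fintype ι] (f : ι → ℕ) {i : ℕ} (h : i ≤ ∑ a, f a) :
    ∃ f' : ι → ℕ, f' ≤ f ∧ ∑ a, f' a = i := by
  classical
  induction h using Nat.decreasingInduction with
  | self => exact ⟨f, le_rfl, rfl⟩
  | of_succ i _ ih =>
    obtain ⟨f', hf', hs⟩ := ih
    obtain ⟨a, ha⟩ : ∃ a, f' a ≠ 0 := by
      by_contra! h
      simp [h] at hs
    refine ⟨Function.update f' a (f' a - 1), fun c => ?_, ?_⟩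
    · by_cases hc : c = a
      · subst hc
        exact (by simp : Function.update f' c (f' c - 1) c ≤ f' c).trans (hf' c)
      · simpa [hc] using hf' c
    · have h1 := Finset.sum_update_of_mem (Finset.mem_univ a) f' (f' a - 1)
      have h2 := Finset.sum_update_of_mem (Finset.mem_univ a) f' (f' a)
      rw [Function.update_eq_self] at h2
      omega

section Coordinates

variable {b : ℕ} {v : Gen n → σ}

theorem sum_genExp_x₀ (hv : Function.Injective v) (c : Gen n → ℕ) :
    (∑ i, c i • genExp b v i) (v (Sum.inl 0)) = (2 * b - 1) * ∑ a, c (Sum.inr a) := by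
  classical
  simp [Fintype.sum_sum_type, Fin.sum_univ_three, genExp, hv.eq_iff,
    Finset.mul_sum, mul_comm]

theorem sum_genExp_x (hv : Function.Injective v) (c : Gen n → ℕ) :
    (∑ i, c i • genExp b v i) (v (Sum.inl 1)) =
      (2 * b + 1) * c (Sum.inl 0) + 2 * c (Sum.inl 1) := by
  classical
  simp [Fintype.sum_sum_type, Fin.sum_univ_three, genExp, hv.eq_iff]
  ring

theorem sum_genExp_y (hv : Function.Injective v) (c : Gen n → ℕ) :
    (∑ i, c i • genExp b v i) (v (Sum.inl 2)) =
      (2 * b - 1) * c (Sum.inl 1) + (2 * b + 1) * c (Sum.inl 2) := by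
  classical
  simp [Fintype.sum_sum_type, Fin.sum_univ_three, genExp, hv.eq_iff]
  ring

theorem sum_genExp_vertex (hv : Function.Injective v) (c : Gen n → ℕ) (j : Fin n) (l : Fin 3) :
    (∑ i, c i • genExp b v i) (v (Sum.inr (j, l))) =
      c (Sum.inr (j, l + 1)) + c (Sum.inr (j, l + 2)) := by
  classical
  have e1 : ∀ a : Fin n × Fin 3, (a.1, a.2 + 1) = (j, l) ↔ a = (j, l + 2) := by
    have : ∀ p q : Fin 3, p + 1 = q ↔ p = q + 2 := by decide
    rintro ⟨p, q⟩
    simp only [Prod.mk.injEq, this]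
  have e2 : ∀ a : Fin n × Fin 3, (a.1, a.2 + 2) = (j, l) ↔ a = (j, l + 1) := by
    have : ∀ p q : Fin 3, p + 2 = q ↔ p = q + 1 := by decide
    rintro ⟨p, q⟩
    simp only [Prod.mk.injEq, this]
  have h : ∀ a : Fin n × Fin 3, genExp b v (Sum.inr a) (v (Sum.inr (j, l))) =
      (if a = (j, l + 2) then 1 else 0) + (if a = (j, l + 1) then 1 else 0) := by
    intro a
    simp only [genExp, Finsupp.add_apply, Finsupp.single_apply, hv.eq_iff, Sum.inr.injEq,
      reduceCtorEq, if_false, zero_add, e1, e2]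
  rw [Finsupp.finsetSum_apply, Fintype.sum_sum_type, Fin.sum_univ_three]
  simp only [Finsupp.smul_apply, h]
  simp [genExp, hv.eq_iff, mul_add, Finset.sum_add_distrib, add_comm]

theorem sum_genExp_of_notMem {s : σ} (hs : s ∉ Set.range v) (c : Gen n → ℕ) :
    (∑ i, c i • genExp b v i) s = 0 := by
  classical
  have h : ∀ a, v a ≠ s := fun a ha => hs ⟨a, ha⟩
  simp [Fintype.sum_sum_type, Fin.sum_univ_three, genExp, h]

end Coordinates

/-- The blocks of variables are disjoint, so the conditions separate; only the number `i` of
triangle generators couples them. -/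
theorem monomial_mem_genIdeal_pow_iff {K : Type*} [Field K] {b : ℕ} {v : Gen n → σ}
    (hv : Function.Injective v) (k : ℕ) (m : σ →₀ ℕ) :
    monomial m (1 : K) ∈ genIdeal K b v ^ k ↔
      MixedPow b k (m (v (Sum.inl 0))) (m (v (Sum.inl 1))) (m (v (Sum.inl 2)))
        (fun j l => m (v (Sum.inr (j, l)))) := by
  rw [genIdeal, monomial_mem_span_pow_iff]
  constructor
  · rintro ⟨c, hc, hm⟩
    have h0 := hm (v (Sum.inl 0))
    have h1 := hm (v (Sum.inl 1))
    have h2 := hm (v (Sum.inl 2))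
    have h3 := fun j l => hm (v (Sum.inr (j, l)))
    rw [sum_genExp_x₀ hv] at h0
    rw [sum_genExp_x hv] at h1
    rw [sum_genExp_y hv] at h2
    simp only [sum_genExp_vertex hv] at h3
    refine ⟨∑ a, c (Sum.inr a), c (Sum.inl 0) + c (Sum.inl 1) + c (Sum.inl 2), ?_,
      ⟨_, _, _, le_rfl, h1, h2⟩, h0, fun j => ∑ l, c (Sum.inr (j, l)), ?_, fun j => ?_⟩
    · rw [Fintype.sum_sum_type, Fin.sum_univ_three] at hc
      omega
    · rw [Fintype.sum_prod_type]
    · refine ⟨fun l => c (Sum.inr (j, l)), (Fin.sum_univ_three _).le, h3 j 0, ?_, ?_⟩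
      · rw [add_comm]; exact h3 j 1
      · exact h3 j 2
  · rintro ⟨i, j, hk, ⟨p, q, r, hj, hX, hY⟩, hC, s, hi, hs⟩
    choose f hf h0 h1 h2 using hs
    have hsum : i ≤ ∑ a : Fin n × Fin 3, f a.1 a.2 := by
      rw [Fintype.sum_prod_type]
      refine hi.trans (Finset.sum_le_sum fun j _ => ?_)
      rw [Fin.sum_univ_three]
      exact hf j
    obtain ⟨f', hf', hsum'⟩ := exists_le_sum_eq _ hsum
    set c : Gen n → ℕ := Sum.elim ![p, q, r] f' with hc
    suffices h : ∑ i, c i • genExp b v i ≤ m by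
      have hck : k ≤ ∑ a, c a := by
        rw [Fintype.sum_sum_type, Fin.sum_univ_three]
        simp only [hc, Sum.elim_inl, Sum.elim_inr, hsum']
        simp
        omega
      obtain ⟨c', hc', hsc⟩ := exists_le_sum_eq _ hck
      refine ⟨c', hsc, le_trans (Finset.sum_le_sum fun a _ => ?_) h⟩
      exact smul_le_smul_of_nonneg_right (hc' a) (zero_le)
    intro s
    by_cases hs : s ∈ Set.range v
    · obtain ⟨a, rfl⟩ := hs
      rcases a with a | ⟨a, l⟩
      · fin_cases a
        · have := sum_genExp_x₀ (b := b) hv c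
          simp only [hc, Sum.elim_inr, hsum'] at this
          exact this.trans_le hC
        · exact (sum_genExp_x hv c).trans_le hX
        · exact (sum_genExp_y hv c).trans_le hY
      · refine (sum_genExp_vertex hv c a l).trans_le ?_
        simp only [hc, Sum.elim_inr]
        have h3 := fun l => hf' (a, l)
        fin_cases l
        · exact (add_le_add (h3 1) (h3 2)).trans (h0 a)
        · exact (add_le_add (h3 2) (h3 0)).trans (by simpa [add_comm] using h1 a)
        · exact (add_le_add (h3 0) (h3 1)).trans (h2 a)
    · rw [sum_genExp_of_notMem hs]
      exact zero_le

end GenIdeal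

/-! ### Socle elements modulo powers of the ideal in `x` and `y` -/

section Plane

variable {b : ℕ}

theorem PlanePow.mono {j j' X X' Y Y' : ℕ} (h : PlanePow b j X Y) (hj : j' ≤ j) (hX : X ≤ X')
    (hY : Y ≤ Y') : PlanePow b j' X' Y' := by
  obtain ⟨p, q, r, h0, h1, h2⟩ := h
  exact ⟨p, q, r, hj.trans h0, h1.trans hX, h2.trans hY⟩

theorem planePow_zero (X Y : ℕ) : PlanePow b 0 X Y := ⟨0, 0, 0, by simp⟩

theorem PlanePow.degree_le (hb : 1 ≤ b) {j X Y : ℕ} (h : PlanePow b j X Y) :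
    (2 * b + 1) * j ≤ X + Y := by
  obtain ⟨p, q, r, h0, h1, h2⟩ := h
  obtain ⟨b, rfl⟩ := Nat.exists_eq_add_of_le' hb
  have e : 2 * (b + 1) - 1 = 2 * b + 1 := by omega
  rw [e] at h2
  nlinarith [Nat.mul_le_mul_left (2 * (b + 1) + 1) h0]

/-- A socle element of least possible degree exists only in the powers with exponent at least
`b`. -/
theorem PlanePow.le_of_socle_degree (hb : 1 ≤ b) {j X Y : ℕ} (hd : X + Y + 1 = (2 * b + 1) * j)
    (hx : PlanePow b j (X + 1) Y) (hy : PlanePow b j X (Y + 1)) : b ≤ j := by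
  obtain ⟨p, q, r, h0, h1, h2⟩ := hx
  obtain ⟨p', q', r', h0', h1', h2'⟩ := hy
  obtain ⟨b, rfl⟩ := Nat.exists_eq_add_of_le' hb
  have e : 2 * (b + 1) - 1 = 2 * b + 1 := by omega
  rw [e] at h2 h2'
  -- By the degree assumption both products have exactly `j` factors and no excess, so the bounds on
  -- the exponents of `x` are equalities.
  have hs : p + q + r ≤ j := by
    by_contra! h
    nlinarith [Nat.mul_le_mul_left (2 * (b + 1) + 1) h]
  have hs' : p' + q' + r' ≤ j := by
    by_contra! h
    nlinarith [Nat.mul_le_mul_left (2 * (b + 1) + 1) h]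
  have hX : X + 1 ≤ (2 * (b + 1) + 1) * p + 2 * q := by
    nlinarith [Nat.mul_le_mul_left (2 * (b + 1) + 1) h0]
  have hX' : X ≤ (2 * (b + 1) + 1) * p' + 2 * q' := by
    nlinarith [Nat.mul_le_mul_left (2 * (b + 1) + 1) h0']
  -- With `B` the original parameter, now `b + 1`, subtracting gives `(2B+1)(p - p') + 2(q - q') =
  -- 1`. So `p ≠ p'` by parity, and `|q - q'| ≥ B`; hence `q` or `q'` is at least `B`.
  rcases lt_trichotomy p p' with h | h | h
  · obtain ⟨t, rfl⟩ := Nat.exists_eq_add_of_lt h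
    nlinarith [Nat.zero_le (b * t)]
  · subst h; omega
  · obtain ⟨t, rfl⟩ := Nat.exists_eq_add_of_lt h
    nlinarith [Nat.zero_le (b * t)]

/-- `x^X y^Y` represents a socle element modulo the `k`-th power of
`(x^(2b+1), x^2 y^(2b-1), y^(2b+1))` and lies in the `(k-1)`-st power. -/
structure IsPlaneSocle (b k X Y : ℕ) : Prop where
  notMem : ¬ PlanePow b k X Y
  x_mul : PlanePow b k (X + 1) Y
  y_mul : PlanePow b k X (Y + 1)
  mem_pred : PlanePow b (k - 1) X Y

/-- The degree is `(2b+1)k - 1`, too small for the `k`-th power. Multiplication by `x` gives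
`x^(2b+1) (y^(2b+1))^(k-1)`, and multiplication by `y` gives `(x²y^(2b-1))^b (y^(2b+1))^(k-b)`. -/
theorem isPlaneSocle_of_le (hb : 1 ≤ b) {k : ℕ} (hk : b ≤ k) :
    IsPlaneSocle b k (2 * b) ((2 * b + 1) * (k - 1)) := by
  obtain ⟨t, rfl⟩ := Nat.exists_eq_add_of_le hk
  obtain ⟨b, rfl⟩ := Nat.exists_eq_add_of_le' hb
  have e : b + 1 + t - 1 = b + t := by omega
  rw [e]
  refine ⟨fun h => ?_, ⟨1, 0, b + t, by omega, by omega, by omega⟩,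
    ⟨0, b + 1, t, by omega, by omega, ?_⟩, ⟨0, 0, b + t, by omega, by omega, by omega⟩⟩
  · have := h.degree_le (by omega)
    nlinarith
  · have e' : 2 * (b + 1) - 1 = 2 * b + 1 := by omega
    rw [e']
    nlinarith

/-- For small `k` the degree is not minimal: `x^((2b+1)(k-1)+2b) y^(2b-2)` works, since its exponent
of `y` is too small for any generator involving `y`. -/
theorem exists_isPlaneSocle (hb : 1 ≤ b) {k : ℕ} (hk : 1 ≤ k) : ∃ X Y, IsPlaneSocle b k X Y := by
  obtain ⟨k, rfl⟩ := Nat.exists_eq_add_of_le' hk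
  obtain ⟨b, rfl⟩ := Nat.exists_eq_add_of_le' hb
  have e' : 2 * (b + 1) - 1 = 2 * b + 1 := by omega
  refine ⟨(2 * b + 3) * k + 2 * b + 2, 2 * b, ?_, ?_, ?_, ?_⟩
  · rintro ⟨p, q, r, h0, h1, h2⟩
    rw [e'] at h2
    have hq : q = 0 := by
      by_contra hq
      nlinarith [Nat.mul_le_mul_left (2 * b + 1) (Nat.one_le_iff_ne_zero.2 hq)]
    have hr : r = 0 := by
      by_contra hr
      nlinarith [Nat.mul_le_mul_left (2 * (b + 1) + 1) (Nat.one_le_iff_ne_zero.2 hr)]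
    subst hq hr
    nlinarith [Nat.mul_le_mul_left (2 * (b + 1) + 1) h0]
  · refine ⟨k + 1, 0, 0, by omega, ?_, by omega⟩
    nlinarith
  · refine ⟨k, 1, 0, by omega, ?_, by omega⟩
    nlinarith
  · refine ⟨k, 0, 0, by omega, ?_, by omega⟩
    simp only [mul_zero]
    nlinarith

end Plane

/-! ### Powers of the edge ideals of triangles -/

section Triangles

theorem TrianglePow.mono {s s' : ℕ} {τ τ' : Fin 3 → ℕ} (h : TrianglePow s τ) (hs : s' ≤ s)
    (hτ : τ ≤ τ') : TrianglePow s' τ' := by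
  obtain ⟨f, h, h0, h1, h2⟩ := h
  exact ⟨f, hs.trans h, h0.trans (hτ 0), h1.trans (hτ 1), h2.trans (hτ 2)⟩

theorem trianglePow_zero (τ : Fin 3 → ℕ) : TrianglePow 0 τ := ⟨0, by simp⟩

theorem TrianglePow.degree_le {s : ℕ} {τ : Fin 3 → ℕ} (h : TrianglePow s τ) :
    2 * s ≤ ∑ l, τ l := by
  obtain ⟨f, h, h0, h1, h2⟩ := h
  rw [Fin.sum_univ_three]
  omega

/-- A monomial in a single vertex of a triangle lies in no positive power of the edge ideal. -/
theorem TrianglePow.eq_zero {s : ℕ} {τ : Fin 3 → ℕ} (h : TrianglePow s τ) (l : Fin 3)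
    (hl : ∀ l', l' ≠ l → τ l' = 0) : s = 0 := by
  obtain ⟨f, h, h0, h1, h2⟩ := h
  have a0 := hl 0
  have a1 := hl 1
  have a2 := hl 2
  fin_cases l <;> simp at a0 a1 a2 <;> omega

theorem trianglePow_one_of_ne {τ : Fin 3 → ℕ} {l l' : Fin 3} (hl : l ≠ l') (h : τ l ≠ 0)
    (h' : τ l' ≠ 0) : TrianglePow 1 τ := by
  rcases (by decide : ∀ l l' : Fin 3, l ≠ l' → ∃ a, (l = a + 1 ∧ l' = a + 2) ∨
    (l' = a + 1 ∧ l = a + 2)) l l' hl with ⟨a, ⟨rfl, rfl⟩ | ⟨rfl, rfl⟩⟩ <;>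
  · refine ⟨Pi.single a 1, ?_⟩
    fin_cases a <;> simp at * <;> omega

variable {n : ℕ}

theorem TrianglesPow.mono {i i' : ℕ} {τ τ' : Fin n → Fin 3 → ℕ} (h : TrianglesPow i τ)
    (hi : i' ≤ i) (hτ : τ ≤ τ') : TrianglesPow i' τ' := by
  obtain ⟨s, h, hs⟩ := h
  exact ⟨s, hi.trans h, fun j => (hs j).mono le_rfl (hτ j)⟩

theorem trianglesPow_zero (τ : Fin n → Fin 3 → ℕ) : TrianglesPow 0 τ :=
  ⟨0, by simp, fun j => trianglePow_zero _⟩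

theorem TrianglesPow.degree_le {i : ℕ} {τ : Fin n → Fin 3 → ℕ} (h : TrianglesPow i τ) :
    2 * i ≤ ∑ j, ∑ l, τ j l := by
  obtain ⟨s, h, hs⟩ := h
  calc 2 * i ≤ 2 * ∑ j, s j := by omega
    _ = ∑ j, 2 * s j := Finset.mul_sum _ _ _
    _ ≤ _ := Finset.sum_le_sum fun j _ => (hs j).degree_le

end Triangles

theorem MixedPow.mono {n : ℕ} {b k C C' X X' Y Y' : ℕ} {τ τ' : Fin n → Fin 3 → ℕ}
    (h : MixedPow b k C X Y τ) (hC : C ≤ C') (hX : X ≤ X') (hY : Y ≤ Y') (hτ : τ ≤ τ') :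
    MixedPow b k C' X' Y' τ' := by
  obtain ⟨i, j, hk, h1, h2, h3⟩ := h
  exact ⟨i, j, hk, h1.mono le_rfl hX hY, h2.trans hC, h3.mono le_rfl hτ⟩

theorem MixedPow.degree_le {n : ℕ} {b k C X Y : ℕ} (hb : 1 ≤ b) {τ : Fin n → Fin 3 → ℕ}
    (h : MixedPow b k C X Y τ) : (2 * b + 1) * k ≤ C + X + Y + ∑ j, ∑ l, τ j l := by
  obtain ⟨i, j, hk, h1, h2, h3⟩ := h
  have := h1.degree_le hb
  have := h3.degree_le
  obtain ⟨b, rfl⟩ := Nat.exists_eq_add_of_le' hb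
  have e : 2 * (b + 1) - 1 = 2 * b + 1 := by omega
  rw [e] at h2
  nlinarith [Nat.mul_le_mul_left (2 * (b + 1) + 1) hk]

/-! ### Constraints on witnesses: their primes and their degrees -/

section Witness

variable {n : ℕ} {σ K : Type*} [Field K] {b k : ℕ} {v : Gen n → σ} {F : Set σ} {m : σ →₀ ℕ}

/-- The exponents of the vertices of the triangles. -/
def vertexExp (v : Gen n → σ) (m : σ →₀ ℕ) : Fin n → Fin 3 → ℕ := fun j l => m (v (Sum.inr (j, l)))

/-- The monomial with exponent `m` lies in the `k`-th power of `genIdeal K b v`. -/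
def ExpPow (b k : ℕ) (v : Gen n → σ) (m : σ →₀ ℕ) : Prop :=
  MixedPow b k (m (v (Sum.inl 0))) (m (v (Sum.inl 1))) (m (v (Sum.inl 2))) (vertexExp v m)

theorem isWitness_iff (hv : Function.Injective v) :
    IsWitness (genIdeal K b v ^ k) F m ↔ ∀ e, ExpPow b k v (m + e) ↔ ∃ i ∈ F, e i ≠ 0 :=
  forall_congr' fun e => by rw [monomial_mem_genIdeal_pow_iff hv]; rfl

theorem ExpPow.mono {m' : σ →₀ ℕ} (h : ExpPow b k v m) (hm : m ≤ m') : ExpPow b k v m' :=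
  MixedPow.mono h (hm _) (hm _) (hm _) fun _ _ => hm _

theorem isWitness_of (hv : Function.Injective v)
    (hF : ∀ s ∈ F, ExpPow b k v (m + Finsupp.single s 1))
    (hn : ∀ e : σ →₀ ℕ, (∀ s ∈ F, e s = 0) → ¬ ExpPow b k v (m + e)) :
    IsWitness (genIdeal K b v ^ k) F m := by
  refine (isWitness_iff hv).2 fun e => ⟨fun h => ?_, ?_⟩
  · by_contra! h'
    exact hn e h' h
  · rintro ⟨s, hs, he⟩
    refine (hF s hs).mono (add_le_add le_rfl ?_)
    rw [Finsupp.single_le_iff]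
    omega

theorem sum_le_degree [Finite σ] (hv : Function.Injective v) (m : σ →₀ ℕ) :
    m (v (Sum.inl 0)) + m (v (Sum.inl 1)) + m (v (Sum.inl 2)) + ∑ j, ∑ l, vertexExp v m j l ≤
      m.degree := by
  classical
  have := Fintype.ofFinite σ
  have h : ∑ a, m (v a) ≤ ∑ s, m s := by
    rw [← Finset.sum_image (g := v) (f := m) hv.injOn]
    exact Finset.sum_le_sum_of_subset (Finset.subset_univ _)
  rw [Fintype.sum_sum_type, Fin.sum_univ_three, Fintype.sum_prod_type] at h
  rw [Finsupp.degree_eq_sum]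
  exact h

theorem add_single_apply (hv : Function.Injective v) (m : σ →₀ ℕ) (a a' : Gen n) (c : ℕ) :
    (m + Finsupp.single (v a) c) (v a') = m (v a') + if a = a' then c else 0 := by
  classical
  rw [Finsupp.add_apply, Finsupp.single_apply]
  simp only [hv.eq_iff]

theorem vertexExp_add_single_inl (hv : Function.Injective v) (m : σ →₀ ℕ) (a : Fin 3) (c : ℕ) :
    vertexExp v (m + Finsupp.single (v (Sum.inl a)) c) = vertexExp v m := by
  ext j l
  simp [vertexExp, hv.eq_iff]

theorem vertexExp_add_single_inr (hv : Function.Injective v) (m : σ →₀ ℕ) (j j' : Fin n)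
    (l l' : Fin 3) (c : ℕ) :
    vertexExp v (m + Finsupp.single (v (Sum.inr (j, l))) c) j' l' =
      vertexExp v m j' l' + if j = j' ∧ l = l' then c else 0 := by
  simp only [vertexExp, add_single_apply hv, Sum.inr.injEq, Prod.mk.injEq]

section Consequences

variable (hv : Function.Injective v) (h : ∀ e, ExpPow b k v (m + e) ↔ ∃ i ∈ F, e i ≠ 0)
include h

theorem not_expPow_of_witness : ¬ ExpPow b k v m := by
  have := h 0
  simp only [add_zero] at this
  rw [this]
  simp

theorem expPow_add_single_of_witness {s : σ} (hs : s ∈ F) :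
    ExpPow b k v (m + Finsupp.single s 1) :=
  (h _).2 ⟨s, hs, by simp⟩

theorem subset_range_of_witness : F ⊆ Set.range v := by
  intro s hs
  by_contra hr
  have h1 := expPow_add_single_of_witness h hs
  have e : ∀ a, (m + Finsupp.single s 1 : σ →₀ ℕ) (v a) = m (v a) := fun a => by
    rw [Finsupp.add_apply, Finsupp.single_eq_of_ne (fun ha => hr ⟨a, ha⟩), add_zero]
  refine not_expPow_of_witness h ?_
  have e' : vertexExp v (m + Finsupp.single s 1) = vertexExp v m := by
    ext j l
    exact e _
  simpa only [ExpPow, e, e'] using h1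

include hv

theorem x_mem_of_witness : v (Sum.inl 1) ∈ F := by
  obtain ⟨s, hs, h1⟩ := (h (Finsupp.single (v (Sum.inl 1)) ((2 * b + 1) * k))).1
    ⟨0, k, by simp, ⟨k, 0, 0, by simp, by simp [add_single_apply hv], by simp⟩, by simp,
      trianglesPow_zero _⟩
  rwa [← (Finsupp.single_apply_ne_zero.1 h1).1]

theorem y_mem_of_witness : v (Sum.inl 2) ∈ F := by
  obtain ⟨s, hs, h1⟩ := (h (Finsupp.single (v (Sum.inl 2)) ((2 * b + 1) * k))).1
    ⟨0, k, by simp, ⟨0, 0, k, by simp, by simp, by simp [add_single_apply hv]⟩, by simp,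
      trianglesPow_zero _⟩
  rwa [← (Finsupp.single_apply_ne_zero.1 h1).1]

/-- The `k`-th power of the generator `x₀^(2b-1)` times an edge lies in `I^k`, so one of its three
variables lies in `F`. -/
theorem edge_mem_of_witness (j : Fin n) {l l' : Fin 3} (hl : l ≠ l') :
    v (Sum.inl 0) ∈ F ∨ v (Sum.inr (j, l)) ∈ F ∨ v (Sum.inr (j, l')) ∈ F := by
  classical
  have key : ∀ a : Fin 3, ExpPow b k v (m + (Finsupp.single (v (Sum.inl 0)) ((2 * b - 1) * k) +
      (Finsupp.single (v (Sum.inr (j, a + 1))) k + Finsupp.single (v (Sum.inr (j, a + 2))) k))) := by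
    intro a
    refine ⟨k, 0, by simp, planePow_zero _ _, ?_, Pi.single j k, by simp, fun j' => ?_⟩
    · simp [hv.eq_iff]
    · by_cases hj : j' = j
      · subst hj
        refine ⟨Pi.single a k, ?_⟩
        rw [Pi.single_eq_same]
        fin_cases a <;> simp [vertexExp, hv.eq_iff]
      · rw [Pi.single_eq_of_ne hj]
        exact trianglePow_zero _
  have key' : ∀ a : Fin 3, v (Sum.inl 0) ∈ F ∨ v (Sum.inr (j, a + 1)) ∈ F ∨
      v (Sum.inr (j, a + 2)) ∈ F := by
    intro a
    obtain ⟨s, hs, h1⟩ := (h _).1 (key a)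
    by_contra! hno
    apply h1
    have e0 : v (Sum.inl 0) ≠ s := fun e => hno.1 (e ▸ hs)
    have e1 : v (Sum.inr (j, a + 1)) ≠ s := fun e => hno.2.1 (e ▸ hs)
    have e2 : v (Sum.inr (j, a + 2)) ≠ s := fun e => hno.2.2 (e ▸ hs)
    simp [e0, e1, e2]
  rcases (by decide : ∀ l l' : Fin 3, l ≠ l' → ∃ a, (l = a + 1 ∧ l' = a + 2) ∨
    (l' = a + 1 ∧ l = a + 2)) l l' hl with ⟨a, ⟨rfl, rfl⟩ | ⟨rfl, rfl⟩⟩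
  · exact key' a
  · exact (key' a).imp_right Or.symm

/-- Multiplying by `x₀` leaves the vertex part alone, and multiplying by a vertex leaves the
exponent of `x₀` alone. Of the two decompositions, the one with fewer triangle factors is therefore
valid for `m` itself. -/
theorem vertex_notMem_of_witness (h0 : v (Sum.inl 0) ∈ F) (j : Fin n) (l : Fin 3) :
    v (Sum.inr (j, l)) ∉ F := by
  intro hjl
  obtain ⟨i, q, hk, h1, h2, h3⟩ := expPow_add_single_of_witness h h0
  obtain ⟨i', q', hk', h1', h2', h3'⟩ := expPow_add_single_of_witness h hjl
  simp only [add_single_apply hv, vertexExp_add_single_inl hv, if_true, reduceCtorEq, if_false,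
    add_zero, Sum.inl.injEq, Fin.reduceEq] at h1 h2 h3 h1' h2'
  refine not_expPow_of_witness h ?_
  rcases le_or_gt i i' with hi | hi
  · exact ⟨i, q, hk, h1, (Nat.mul_le_mul_left _ hi).trans h2', h3⟩
  · exact ⟨i', q', hk', h1', h2', h3.mono hi.le le_rfl⟩

/-- Comparison of the decompositions that come from `x` and from another variable of the prime. -/
theorem degree_of_witness [Finite σ] (hb : 1 ≤ b) (hn : 0 < n) :
    (2 * b + 1) * (k + 1) ≤ m.degree + 2 ∧
      (m.degree + 2 = (2 * b + 1) * (k + 1) → b ≤ k) := by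
  obtain ⟨z, hzF, hz⟩ : ∃ a : Gen n, v a ∈ F ∧ a ≠ Sum.inl 1 ∧ a ≠ Sum.inl 2 := by
    rcases edge_mem_of_witness hv h ⟨0, hn⟩ (zero_ne_one' (Fin 3)) with h | h | h
    exacts [⟨_, h, by simp⟩, ⟨_, h, by simp⟩, ⟨_, h, by simp⟩]
  have hnot := not_expPow_of_witness h
  obtain ⟨i, q, hk, h1, h2, h3⟩ := expPow_add_single_of_witness h (x_mem_of_witness hv h)
  obtain ⟨i₂, q₂, hk₂, h1₂, h2₂, h3₂⟩ := expPow_add_single_of_witness h (y_mem_of_witness hv h)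
  obtain ⟨i', q', hk', h1', h2', h3'⟩ := expPow_add_single_of_witness h hzF
  have hdz : (m + Finsupp.single (v z) 1 : σ →₀ ℕ) (v (Sum.inl 0)) +
      ∑ j, ∑ l, vertexExp v (m + Finsupp.single (v z) 1) j l =
      m (v (Sum.inl 0)) + ∑ j, ∑ l, vertexExp v m j l + 1 := by
    rcases z with z | ⟨j, l⟩
    · fin_cases z
      · simp only [add_single_apply hv, Fin.zero_eta, vertexExp_add_single_inl hv, if_true]
        omega
      · simp at hz
      · simp at hz
    · simp only [add_single_apply hv, vertexExp_add_single_inr hv, Finset.sum_add_distrib]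
      simp [ite_and, add_assoc]
  simp only [add_single_apply hv, vertexExp_add_single_inl hv, if_true, if_false,
    add_zero, Sum.inl.injEq, Fin.reduceEq, hz.1, hz.2] at h1 h2 h3 h1₂ h2₂ h3₂ h1'
  -- Since `z` is neither `x` nor `y`, the plane part of `m·z` is that of `m`. If `i' ≤ i`, it would
  -- combine with the remaining part for `i` to put `m` into `I^k`.
  have hi : ∀ {i}, (2 * b - 1) * i ≤ m (v (Sum.inl 0)) → TrianglesPow i (vertexExp v m) →
      i < i' := by
    intro i h2 h3
    by_contra! hi
    exact hnot ⟨i', q', hk', h1', (Nat.mul_le_mul_left _ hi).trans h2, h3.mono hi le_rfl⟩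
  have hi₁ := hi h2 h3
  have hi₂ := hi h2₂ h3₂
  have d1 := h1.degree_le hb
  have d3' := h3'.degree_le
  have hdeg := sum_le_degree hv m
  have hdA : (2 * b + 1) * i' = (2 * b - 1) * i' + 2 * i' := by
    rw [← add_mul]
    congr 1
    omega
  -- `m·x` pays for `q` plane factors and `m·z` for `i'` triangle factors, where `q + i' > q + i ≥
  -- k`. The two extra variables account for the `2` in the bound.
  have hmul : (2 * b + 1) * (k + 1) ≤ (2 * b + 1) * (q + i') := Nat.mul_le_mul_left _ (by omega)
  rw [mul_add _ q] at hmul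
  refine ⟨by omega, fun heq => ?_⟩
  have hii : q + i' ≤ k + 1 := by
    by_contra! hlt
    have := Nat.mul_le_mul_left (2 * b + 1) hlt
    rw [mul_add _ q, Nat.succ_eq_add_one, mul_add _ (k + 1)] at this
    omega
  have hb' := PlanePow.le_of_socle_degree hb (j := q) (X := m (v (Sum.inl 1)))
    (Y := m (v (Sum.inl 2))) (by omega) h1 (h1₂.mono (by omega) le_rfl le_rfl)
  omega

theorem degree_of_witness_of_eq_zero [Finite σ] (hb : 1 ≤ b) (hn : n = 0) :
    (2 * b + 1) * k ≤ m.degree + 1 ∧ (m.degree + 1 = (2 * b + 1) * k → b ≤ k) := by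
  subst hn
  obtain ⟨i, q, hk, h1, h2, h3⟩ := expPow_add_single_of_witness h (x_mem_of_witness hv h)
  obtain ⟨i₂, q₂, hk₂, h1₂, h2₂, h3₂⟩ := expPow_add_single_of_witness h (y_mem_of_witness hv h)
  have hi := h3.degree_le
  have hi₂ := h3₂.degree_le
  simp only [Finset.univ_eq_empty, Finset.sum_empty] at hi hi₂
  simp only [add_single_apply hv, if_true, add_zero, Sum.inl.injEq, Fin.reduceEq,
    if_false] at h1 h1₂
  have hdeg := sum_le_degree hv m
  replace h1 := h1.mono (show k ≤ q by omega) le_rfl le_rfl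
  have d1 := h1.degree_le hb
  refine ⟨by omega, fun heq => ?_⟩
  exact PlanePow.le_of_socle_degree hb (by omega) h1
    (h1₂.mono (show k ≤ q₂ by omega) le_rfl le_rfl)

/-- The prime generated by `x`, `y` and all vertices of the triangles occurs only from the power
`n + 1` on. -/
theorem lt_of_witness_of_vertices (hF : ∀ j l, v (Sum.inr (j, l)) ∈ F) : n < k := by
  have hnot := not_expPow_of_witness h
  -- If `m` involves at most one vertex `l` of triangle `j`, then so does its product with that
  -- vertex; triangle `j` then contributes no factor, and the decomposition is valid for `m`.
  have h1 : ∀ j, TrianglePow 1 (vertexExp v m j) := by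
    intro j
    by_contra hj
    obtain ⟨l, hl⟩ : ∃ l, ∀ l', l' ≠ l → vertexExp v m j l' = 0 := by
      by_contra! hno
      obtain ⟨l₁, -, h₁⟩ := hno 0
      obtain ⟨l₂, h₂', h₂⟩ := hno l₁
      exact hj (trianglePow_one_of_ne h₂' h₂ h₁)
    obtain ⟨i, q, hk, h1, h2, s, hi, hs⟩ := expPow_add_single_of_witness h (hF j l)
    simp only [add_single_apply hv, reduceCtorEq, if_false, add_zero] at h1 h2
    refine hnot ⟨i, q, hk, h1, h2, s, hi, fun j' => ?_⟩
    by_cases hjj : j = j'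
    · subst hjj
      rw [(hs j).eq_zero l]
      · exact trianglePow_zero _
      · intro l' hl'
        rw [vertexExp_add_single_inr hv, hl l' hl', if_neg (fun h => hl' h.2.symm)]
    · refine (hs j').mono le_rfl fun l' => ?_
      rw [vertexExp_add_single_inr hv, if_neg (fun h => hjj h.1), add_zero]
  have hT : TrianglesPow n (vertexExp v m) := ⟨fun _ => 1, by simp, h1⟩
  by_contra! hk
  rcases Nat.eq_zero_or_pos n with hn | hn
  · exact hnot ⟨0, 0, by omega, planePow_zero _ _, by simp, trianglesPow_zero _⟩
  · obtain ⟨i, q, hk', h1, h2, h3⟩ := expPow_add_single_of_witness h (hF ⟨0, hn⟩ 0)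
    simp only [add_single_apply hv, reduceCtorEq, if_false, add_zero] at h1 h2
    -- The edges in `m` supply up to `n` triangle factors, so `i` may be replaced by `min i n`; if
    -- this is `n ≥ k`, no plane factor is needed.
    rcases le_total i n with hi | hi
    · exact hnot ⟨i, q, hk', h1, h2, hT.mono hi le_rfl⟩
    · exact hnot ⟨n, 0, by omega, planePow_zero _ _, (Nat.mul_le_mul_left _ hi).trans h2, hT⟩

end Consequences

end Witness

/-! ### Construction of witnesses -/

section Existence

variable {n : ℕ} {σ K : Type*} [Field K] {b k : ℕ} {v : Gen n → σ}

/-- The exponent with values `c a` at the variables `v a`, and zero elsewhere. -/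
noncomputable def ofGen (v : Gen n → σ) (c : Gen n → ℕ) : σ →₀ ℕ :=
  ∑ a, Finsupp.single (v a) (c a)

theorem ofGen_apply (hv : Function.Injective v) (c : Gen n → ℕ) (a : Gen n) :
    ofGen v c (v a) = c a := by
  classical
  rw [ofGen, Finsupp.finsetSum_apply]
  simp only [Finsupp.single_apply, hv.eq_iff]
  simp

theorem degree_ofGen (c : Gen n → ℕ) : (ofGen v c).degree = ∑ a, c a := by
  simp [ofGen, map_sum]

theorem vertexExp_ofGen (hv : Function.Injective v) (c : Gen n → ℕ) :
    vertexExp v (ofGen v c) = fun j l => c (Sum.inr (j, l)) := by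
  ext j l
  exact ofGen_apply hv c _

/-- The exponent of `x_0^C x^X y^Y` times the monomial with exponent `τ` in the vertices. -/
noncomputable def mkExp (v : Gen n → σ) (C X Y : ℕ) (τ : Fin n → Fin 3 → ℕ) : σ →₀ ℕ :=
  ofGen v (Sum.elim ![C, X, Y] fun a => τ a.1 a.2)

section mkExp

variable (hv : Function.Injective v) (C X Y : ℕ) (τ : Fin n → Fin 3 → ℕ)
include hv

theorem mkExp_x₀ : mkExp v C X Y τ (v (Sum.inl 0)) = C := ofGen_apply hv _ _

theorem mkExp_x : mkExp v C X Y τ (v (Sum.inl 1)) = X := ofGen_apply hv _ _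

theorem mkExp_y : mkExp v C X Y τ (v (Sum.inl 2)) = Y := ofGen_apply hv _ _

theorem vertexExp_mkExp : vertexExp v (mkExp v C X Y τ) = τ := vertexExp_ofGen hv _

omit hv in
theorem degree_mkExp : (mkExp v C X Y τ).degree = C + X + Y + ∑ j, ∑ l, τ j l := by
  rw [mkExp, degree_ofGen, Fintype.sum_sum_type, Fin.sum_univ_three, Fintype.sum_prod_type]
  rfl

end mkExp

theorem vertexExp_add (m e : σ →₀ ℕ) : vertexExp v (m + e) = vertexExp v m + vertexExp v e := rfl

/-- The prime `(x_0, x, y)`. -/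
def specialPrime (v : Gen n → σ) : Set σ := {v (Sum.inl 0), v (Sum.inl 1), v (Sum.inl 2)}

/-- The exponent `2b - 2` of `x₀` is one short of allowing a triangle factor. Without another `x₀`
only the plane part counts, which is a socle element; with it, the edge replaces the one missing
plane factor. -/
theorem isWitness_specialPrime (hv : Function.Injective v) (hb : 1 ≤ b) (hk : 1 ≤ k) {X Y : ℕ}
    (h : IsPlaneSocle b k X Y) (j₀ : Fin n) :
    IsWitness (genIdeal K b v ^ k) (specialPrime v)
      (mkExp v (2 * b - 2) X Y (Pi.single j₀ ![1, 1, 0])) := by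
  refine isWitness_of hv ?_ ?_
  · rintro s (rfl | rfl | rfl)
    · refine ⟨1, k - 1, by omega, ?_, ?_, Pi.single j₀ 1, by simp, fun j => ?_⟩
      · simpa [add_single_apply hv, mkExp_x hv, mkExp_y hv] using h.mem_pred
      · simp only [add_single_apply hv, mkExp_x₀ hv, if_true]
        omega
      · rw [vertexExp_add_single_inl hv, vertexExp_mkExp hv]
        by_cases hj : j = j₀
        · subst hj
          rw [Pi.single_eq_same, Pi.single_eq_same]
          exact ⟨![0, 0, 1], by simp⟩
        · rw [Pi.single_eq_of_ne hj]
          exact trianglePow_zero _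
    · refine ⟨0, k, by omega, ?_, by simp, trianglesPow_zero _⟩
      simpa [add_single_apply hv, mkExp_x hv, mkExp_y hv] using h.x_mul
    · refine ⟨0, k, by omega, ?_, by simp, trianglesPow_zero _⟩
      simpa [add_single_apply hv, mkExp_x hv, mkExp_y hv] using h.y_mul
  · rintro e he ⟨i, q, hk', h1, h2, h3⟩
    have h0 := he _ (Or.inl rfl)
    have hx := he _ (Or.inr (Or.inl rfl))
    have hy := he _ (Or.inr (Or.inr rfl))
    rw [Finsupp.add_apply, Finsupp.add_apply, mkExp_x hv, mkExp_y hv, hx, hy] at h1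
    rw [Finsupp.add_apply, mkExp_x₀ hv, h0] at h2
    have hi : i = 0 := by
      by_contra hi
      have := Nat.mul_le_mul_left (2 * b - 1) (Nat.one_le_iff_ne_zero.2 hi)
      omega
    exact h.notMem (h1.mono (by omega) le_rfl le_rfl)

/-- The prime generated by `x`, `y` and the vertices of the triangles except, for each `j` with
`o j = some l`, the `l`-th vertex of the `j`-th triangle. -/
def vertexPrime (v : Gen n → σ) (o : Fin n → Option (Fin 3)) : Set σ :=
  {v (Sum.inl 1), v (Sum.inl 2)} ∪ {s | ∃ j l, o j ≠ some l ∧ s = v (Sum.inr (j, l))}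

/-- The product of all vertices of the triangles with `o j = none` and of the vertices which
`o` singles out in the other ones. -/
def vertexMonomial (o : Fin n → Option (Fin 3)) : Fin n → Fin 3 → ℕ :=
  fun j l => if o j = none ∨ o j = some l then 1 else 0

/-- The number of triangles all of whose vertices lie in the prime `vertexPrime v o`. -/
def fullCount (o : Fin n → Option (Fin 3)) : ℕ := ∑ j, if o j = none then 1 else 0

theorem fullCount_le (o : Fin n → Option (Fin 3)) : fullCount o ≤ n := by
  have : fullCount o ≤ ∑ _j : Fin n, 1 := Finset.sum_le_sum fun j _ => by split_ifs <;> simp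
  simpa using this

theorem trianglesPow_fullCount (o : Fin n → Option (Fin 3)) :
    TrianglesPow (fullCount o) (vertexMonomial o) := by
  refine ⟨fun j => if o j = none then 1 else 0, le_rfl, fun j => ?_⟩
  dsimp only
  split_ifs with h
  · exact trianglePow_one_of_ne (l := 0) (l' := 1) (by simp) (by simp [vertexMonomial, h])
      (by simp [vertexMonomial, h])
  · exact trianglePow_zero _

theorem trianglesPow_fullCount_succ {o : Fin n → Option (Fin 3)} {j : Fin n} {l : Fin 3}
    (hjl : o j ≠ some l) {τ : Fin n → Fin 3 → ℕ} (hτ : vertexMonomial o ≤ τ)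
    (hτj : vertexMonomial o j l + 1 ≤ τ j l) :
    TrianglesPow (fullCount o + 1) τ := by
  refine ⟨fun i => (if o i = none then 1 else 0) + Pi.single (M := fun _ => ℕ) j 1 i, ?_,
    fun i => ?_⟩
  · simp [Finset.sum_add_distrib, fullCount]
  dsimp only
  by_cases hij : i = j
  · subst hij
    rw [Pi.single_eq_same]
    by_cases hn : o i = none
    · have h1 : ∀ l', 1 ≤ τ i l' := fun l' => by simpa [vertexMonomial, hn] using hτ i l'
      have h2 : 2 ≤ τ i l := by simpa [vertexMonomial, hn] using hτj
      have h10 := h1 0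
      have h11 := h1 1
      have h12 := h1 2
      rw [if_pos hn]
      -- With the vertex `l` doubled, the two edges through `l` fit: `u²vw = (uv)(uw)`.
      refine ⟨fun l' => if l' = l then 0 else 1, ?_⟩
      fin_cases l <;> simp at * <;> omega
    · rw [if_neg hn, zero_add]
      obtain ⟨l', hl'⟩ := Option.ne_none_iff_exists'.1 hn
      refine trianglePow_one_of_ne (l := l) (l' := l') ?_ (by omega) ?_
      · rintro rfl
        exact hjl hl'
      · have : 1 ≤ τ i l' := by simpa [vertexMonomial, hl'] using hτ i l'
        omega
  · rw [Pi.single_eq_of_ne hij, add_zero]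
    split_ifs with h
    · refine trianglePow_one_of_ne (l := 0) (l' := 1) (by simp) ?_ ?_
      · have : 1 ≤ τ i 0 := by simpa [vertexMonomial, h] using hτ i 0
        omega
      · have : 1 ≤ τ i 1 := by simpa [vertexMonomial, h] using hτ i 1
        omega
    · exact trianglePow_zero _

/-- A product of three vertices has degree 3 and so holds only one edge; a power of a single vertex
holds none. -/
theorem TrianglesPow.le_fullCount {o : Fin n → Option (Fin 3)} {τ : Fin n → Fin 3 → ℕ} {i : ℕ}
    (h : TrianglesPow i τ) (hτ : ∀ j l, o j ≠ some l → τ j l = vertexMonomial o j l) :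
    i ≤ fullCount o := by
  obtain ⟨s, hi, hs⟩ := h
  refine hi.trans (Finset.sum_le_sum fun j _ => ?_)
  split_ifs with ho
  · have := (hs j).degree_le
    have e : ∀ l, τ j l = 1 := fun l => by
      rw [hτ j l (by simp [ho])]
      simp [vertexMonomial, ho]
    simp only [e, Finset.sum_const, Finset.card_univ, Fintype.card_fin, smul_eq_mul] at this
    omega
  · obtain ⟨l, hl⟩ := Option.ne_none_iff_exists'.1 ho
    refine ((hs j).eq_zero l fun l' hl' => ?_).le
    have hne : l ≠ l' := hl'.symm
    rw [hτ j l' (by simpa [hl] using hne)]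
    simp [vertexMonomial, hl, hne]

/-- The full triangles supply `fullCount o` factors and the plane part is a socle element for the
rest. Another vertex of the prime gains one triangle factor, making up for the plane part lying only
in the preceding power. This needs more `x₀`, but only when triangles exist, so `C = 0` is allowed
for `n = 0`. -/
theorem isWitness_vertexPrime (hv : Function.Injective v) (o : Fin n → Option (Fin 3))
    (hk : fullCount o < k) {C X Y : ℕ} (h : IsPlaneSocle b (k - fullCount o) X Y)
    (hC : (2 * b - 1) * fullCount o ≤ C) (hC' : 0 < n → (2 * b - 1) * (fullCount o + 1) ≤ C) :
    IsWitness (genIdeal K b v ^ k) (vertexPrime v o) (mkExp v C X Y (vertexMonomial o)) := by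
  refine isWitness_of hv ?_ ?_
  · rintro s ((rfl | rfl) | ⟨j, l, hjl, rfl⟩)
    · refine ⟨fullCount o, k - fullCount o, by omega, ?_, ?_, ?_⟩
      · simpa [add_single_apply hv, mkExp_x hv, mkExp_y hv] using h.x_mul
      · simpa [add_single_apply hv, mkExp_x₀ hv] using hC
      · rw [vertexExp_add_single_inl hv, vertexExp_mkExp hv]
        exact trianglesPow_fullCount o
    · refine ⟨fullCount o, k - fullCount o, by omega, ?_, ?_, ?_⟩
      · simpa [add_single_apply hv, mkExp_x hv, mkExp_y hv] using h.y_mul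
      · simpa [add_single_apply hv, mkExp_x₀ hv] using hC
      · rw [vertexExp_add_single_inl hv, vertexExp_mkExp hv]
        exact trianglesPow_fullCount o
    · refine ⟨fullCount o + 1, k - fullCount o - 1, by omega, ?_, ?_, ?_⟩
      · simpa [add_single_apply hv, mkExp_x hv, mkExp_y hv] using h.mem_pred
      · simpa [add_single_apply hv, mkExp_x₀ hv] using hC' (Nat.zero_lt_of_lt j.2)
      · refine trianglesPow_fullCount_succ hjl (fun j' l' => ?_) ?_
        · rw [vertexExp_add_single_inr hv, vertexExp_mkExp hv]
          exact Nat.le_add_right _ _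
        · rw [vertexExp_add_single_inr hv, vertexExp_mkExp hv, if_pos ⟨rfl, rfl⟩]
  · rintro e he ⟨i, q, hk', h1, h2, h3⟩
    have hx := he _ (Or.inl (Or.inl rfl))
    have hy := he _ (Or.inl (Or.inr rfl))
    rw [Finsupp.add_apply, Finsupp.add_apply, mkExp_x hv, mkExp_y hv, hx, hy] at h1
    have hi : i ≤ fullCount o := h3.le_fullCount fun j l hjl => by
      rw [vertexExp_add, vertexExp_mkExp hv]
      have := he _ (Or.inr ⟨j, l, hjl, rfl⟩)
      simp [vertexExp, this]
    exact h.notMem (h1.mono (by omega) le_rfl le_rfl)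

end Existence

/-! ### Computation of the stability indices -/

section Invariants

variable {n : ℕ} {σ K : Type*} [Field K] {b k : ℕ} {v : Gen n → σ}

theorem isMonomialIdeal_genIdeal_pow (k : ℕ) : IsMonomialIdeal (genIdeal K b v ^ k) :=
  isMonomialIdeal_span_range_pow _ k

theorem x₀_notMem_of_witness {F : Set σ} {m : σ →₀ ℕ} (hv : Function.Injective v)
    (h : ∀ e, ExpPow b k v (m + e) ↔ ∃ i ∈ F, e i ≠ 0) (hn : n = 0) : v (Sum.inl 0) ∉ F := by
  subst hn
  intro h0
  obtain ⟨i, q, hk, h1, h2, h3⟩ := expPow_add_single_of_witness h h0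
  have hi := h3.degree_le
  simp only [Finset.univ_eq_empty, Finset.sum_empty] at hi
  simp only [add_single_apply hv, if_false, add_zero, Sum.inl.injEq, Fin.reduceEq] at h1
  exact not_expPow_of_witness h ⟨0, q, by omega, h1, by simp, trianglesPow_zero _⟩

theorem eq_prime_of_witness {F : Set σ} {m : σ →₀ ℕ} (hv : Function.Injective v)
    (h : ∀ e, ExpPow b k v (m + e) ↔ ∃ i ∈ F, e i ≠ 0) :
    (0 < n ∧ F = specialPrime v) ∨ ∃ o, F = vertexPrime v o := by
  have hx := x_mem_of_witness hv h
  have hy := y_mem_of_witness hv h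
  by_cases h0 : v (Sum.inl 0) ∈ F
  · refine Or.inl ⟨Nat.pos_of_ne_zero fun hn => x₀_notMem_of_witness hv h hn h0, ?_⟩
    ext s
    constructor
    · intro hs
      obtain ⟨a, rfl⟩ := subset_range_of_witness h hs
      rcases a with a | ⟨j, l⟩
      · fin_cases a <;> simp [specialPrime]
      · exact absurd hs (vertex_notMem_of_witness hv h h0 j l)
    · rintro (rfl | rfl | rfl) <;> assumption
  -- Any two vertices of a triangle form an edge, which `F` meets, so at most one vertex is missing.
  · have ho : ∀ j, ∃ o : Option (Fin 3), ∀ l, v (Sum.inr (j, l)) ∈ F ↔ o ≠ some l := by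
      intro j
      by_cases hall : ∀ l, v (Sum.inr (j, l)) ∈ F
      · exact ⟨none, fun l => by simp [hall l]⟩
      · push Not at hall
        obtain ⟨l, hl⟩ := hall
        refine ⟨some l, fun l' => ?_⟩
        by_cases hll : l = l'
        · subst hll
          simp [hl]
        · simpa [hll, hl, h0] using edge_mem_of_witness hv h j hll
    choose o ho using ho
    refine Or.inr ⟨o, ?_⟩
    ext s
    constructor
    · intro hs
      obtain ⟨a, rfl⟩ := subset_range_of_witness h hs
      rcases a with a | ⟨j, l⟩
      · fin_cases a
        · exact absurd hs h0
        · exact Or.inl (Or.inl rfl)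
        · exact Or.inl (Or.inr rfl)
      · exact Or.inr ⟨j, l, (ho j l).1 hs, rfl⟩
    · rintro ((rfl | rfl) | ⟨j, l, hjl, rfl⟩)
      · exact hx
      · exact hy
      · exact (ho j l).2 hjl

theorem exists_isWitness_vertexPrime (hv : Function.Injective v) (hb : 1 ≤ b)
    (o : Fin n → Option (Fin 3)) (hk : fullCount o < k) :
    ∃ m, IsWitness (genIdeal K b v ^ k) (vertexPrime v o) m := by
  obtain ⟨X, Y, h⟩ := exists_isPlaneSocle hb (show 1 ≤ k - fullCount o by omega)
  exact ⟨_, isWitness_vertexPrime hv o hk h (C := (2 * b - 1) * (fullCount o + 1))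
    (Nat.mul_le_mul_left _ (Nat.le_succ _)) fun _ => le_rfl⟩

theorem associatedPrimes_genIdeal_pow [Finite σ] (hv : Function.Injective v) (hb : 1 ≤ b)
    (hk : n + 1 ≤ k) :
    Submodule.associatedPrimes (genIdeal K b v ^ k) =
      {p | ∃ F, p = varIdeal K F ∧ ((0 < n ∧ F = specialPrime v) ∨ ∃ o, F = vertexPrime v o)} := by
  ext p
  rw [mem_associatedPrimes_iff (isMonomialIdeal_genIdeal_pow k)]
  constructor
  · rintro ⟨F, m, hp, hw⟩
    exact ⟨F, hp, eq_prime_of_witness hv ((isWitness_iff hv).1 hw)⟩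
  · rintro ⟨F, hp, ⟨hn, rfl⟩ | ⟨o, rfl⟩⟩
    · obtain ⟨X, Y, h⟩ := exists_isPlaneSocle hb (show 1 ≤ k by omega)
      exact ⟨_, _, hp, isWitness_specialPrime hv hb (by omega) h ⟨0, hn⟩⟩
    · obtain ⟨m, hm⟩ := exists_isWitness_vertexPrime (K := K) (k := k) hv hb o
        (by have := fullCount_le o; omega)
      exact ⟨_, m, hp, hm⟩

theorem astab_genIdeal [Finite σ] (hv : Function.Injective v) (hb : 1 ≤ b) :
    astab (genIdeal K b v) = n + 1 := by
  refine le_antisymm (Nat.sInf_le ⟨by omega, fun k hk => ?_⟩) (le_csInf ⟨n + 1, by omega,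
    fun k hk => ?_⟩ ?_)
  · rw [associatedPrimes_genIdeal_pow hv hb hk, associatedPrimes_genIdeal_pow hv hb le_rfl]
  · rw [associatedPrimes_genIdeal_pow hv hb hk, associatedPrimes_genIdeal_pow hv hb le_rfl]
  · rintro k ⟨hk1, hk⟩
    by_contra! hlt
    have h1 : Submodule.associatedPrimes (genIdeal K b v ^ (n + 1)) =
        Submodule.associatedPrimes (genIdeal K b v ^ k) := hk _ (by omega)
    -- The prime containing all vertices separates the power `n + 1` from all earlier ones.
    have h2 : varIdeal K (vertexPrime v fun _ => none) ∈
        Submodule.associatedPrimes (genIdeal K b v ^ (n + 1)) := by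
      rw [varIdeal_mem_associatedPrimes_iff (isMonomialIdeal_genIdeal_pow _)]
      exact exists_isWitness_vertexPrime hv hb _ (Nat.lt_succ_of_le (fullCount_le _))
    rw [h1, varIdeal_mem_associatedPrimes_iff (isMonomialIdeal_genIdeal_pow _)] at h2
    obtain ⟨m, hm⟩ := h2
    have := lt_of_witness_of_vertices hv ((isWitness_iff hv).1 hm)
      fun j l => Or.inr ⟨j, l, by simp, rfl⟩
    omega

theorem degree_le_of_mem_genIdeal [Finite σ] (hv : Function.Injective v) (hb : 1 ≤ b)
    {m : σ →₀ ℕ} (h : monomial m (1 : K) ∈ genIdeal K b v) : 2 * b + 1 ≤ m.degree := by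
  rw [← pow_one (genIdeal K b v), monomial_mem_genIdeal_pow_iff hv] at h
  have := h.degree_le hb
  have := sum_le_degree hv m
  simp only [vertexExp] at this
  omega

theorem monomial_x_mem_genIdeal :
    monomial (Finsupp.single (v (Sum.inl 1)) (2 * b + 1)) (1 : K) ∈ genIdeal K b v :=
  Ideal.subset_span ⟨Sum.inl 0, rfl⟩

theorem genIdeal_ne_bot : genIdeal K b v ≠ ⊥ := by
  intro h
  have := monomial_x_mem_genIdeal (K := K) (b := b) (v := v)
  rw [h, Ideal.mem_bot] at this
  simp at this

theorem genIdeal_ne_top [Finite σ] (hv : Function.Injective v) (hb : 1 ≤ b) :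
    genIdeal K b v ≠ ⊤ := by
  intro h
  have := degree_le_of_mem_genIdeal (K := K) hv hb (m := 0) (by rw [h]; trivial)
  simp at this

theorem initialDegree_genIdeal [Finite σ] (hv : Function.Injective v) (hb : 1 ≤ b) :
    initialDegree (genIdeal K b v) = 2 * b + 1 := by
  have hmem : 2 * b + 1 ∈ {d : ℕ | ∃ f ∈ genIdeal K b v, f ≠ 0 ∧ f.IsHomogeneous d} :=
    ⟨_, monomial_x_mem_genIdeal, by simp, isHomogeneous_monomial _ (Finsupp.degree_single _ _)⟩
  refine le_antisymm (Nat.sInf_le hmem) (le_csInf ⟨_, hmem⟩ ?_)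
  rintro d ⟨f, hf, hf0, hd⟩
  obtain ⟨m, hm⟩ := MvPolynomial.support_nonempty.2 hf0
  rw [hd.degree_eq_sum_deg_support hm]
  exact degree_le_of_mem_genIdeal hv hb (((isMonomialIdeal_span_range _).mem_iff).1 hf m hm)

theorem vNumber_genIdeal_pow [Finite σ] (hv : Function.Injective v) (hb : 1 ≤ b) (hn : 0 < n)
    (hk : 1 ≤ k) : (2 * b + 1) * (k + 1) ≤ vNumber (genIdeal K b v ^ k) + 2 ∧
      (vNumber (genIdeal K b v ^ k) + 2 = (2 * b + 1) * (k + 1) ↔ b ≤ k) := by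
  have hI : IsMonomialIdeal (genIdeal K b v ^ k) := isMonomialIdeal_genIdeal_pow k
  have hne : ∃ F m, IsWitness (genIdeal K b v ^ k) F m := by
    obtain ⟨X, Y, h⟩ := exists_isPlaneSocle hb hk
    exact ⟨_, _, isWitness_specialPrime hv hb hk h ⟨0, hn⟩⟩
  have hle : (2 * b + 1) * (k + 1) - 2 ≤ vNumber (genIdeal K b v ^ k) :=
    le_vNumber hI hne fun F m hw => by
      have := (degree_of_witness hv ((isWitness_iff hv).1 hw) hb hn).1
      omega
  refine ⟨by omega, fun heq => ?_, fun hbk => le_antisymm ?_ (by omega)⟩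
  · by_contra! hlt
    have : (2 * b + 1) * (k + 1) - 1 ≤ vNumber (genIdeal K b v ^ k) :=
      le_vNumber hI hne fun F m hw => by
        have := degree_of_witness hv ((isWitness_iff hv).1 hw) hb hn
        by_contra! hd
        have := this.2 (by omega)
        omega
    have : 2 ≤ (2 * b + 1) * (k + 1) := by nlinarith
    omega
  -- This witness has degree `(2b-2) + 2 + 2b + (2b+1)(k-1) = (2b+1)(k+1) - 2`.
  · have hw := isWitness_specialPrime (K := K) hv hb hk (isPlaneSocle_of_le hb hbk) ⟨0, hn⟩
    have := hw.vNumber_le hI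
    rw [degree_mkExp, Finset.sum_eq_single (a := ⟨0, hn⟩) (by
      intro j _ hj
      simp [Pi.single_eq_of_ne hj]) (by simp)] at this
    simp only [Pi.single_eq_same, Fin.sum_univ_three] at this
    simp at this
    obtain ⟨t, rfl⟩ := Nat.exists_eq_add_of_le' hk
    rw [Nat.add_sub_cancel] at this
    have e : (2 * b + 1) * (t + 1 + 1) = (2 * b + 1) * t + 2 * (2 * b + 1) := by ring
    omega

theorem vNumber_genIdeal_pow_of_eq_zero [Finite σ] (hv : Function.Injective v) (hb : 1 ≤ b)
    (hn : n = 0) (hk : 1 ≤ k) : (2 * b + 1) * k ≤ vNumber (genIdeal K b v ^ k) + 1 ∧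
      (vNumber (genIdeal K b v ^ k) + 1 = (2 * b + 1) * k ↔ b ≤ k) := by
  have hI : IsMonomialIdeal (genIdeal K b v ^ k) := isMonomialIdeal_genIdeal_pow k
  have hne : ∃ F m, IsWitness (genIdeal K b v ^ k) F m :=
    ⟨_, exists_isWitness_vertexPrime hv hb (fun _ => none)
      ((fullCount_le _).trans_lt (by omega))⟩
  have hle : (2 * b + 1) * k - 1 ≤ vNumber (genIdeal K b v ^ k) :=
    le_vNumber hI hne fun F m hw => by
      have := (degree_of_witness_of_eq_zero hv ((isWitness_iff hv).1 hw) hb hn).1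
      omega
  refine ⟨by omega, fun heq => ?_, fun hbk => le_antisymm ?_ (by omega)⟩
  · by_contra! hlt
    have : (2 * b + 1) * k ≤ vNumber (genIdeal K b v ^ k) :=
      le_vNumber hI hne fun F m hw => by
        have := degree_of_witness_of_eq_zero hv ((isWitness_iff hv).1 hw) hb hn
        by_contra! hd
        have := this.2 (by omega)
        omega
    omega
  · subst hn
    have hw := isWitness_vertexPrime (K := K) (k := k) hv (fun _ => none)
      (by simp [fullCount]; omega) (isPlaneSocle_of_le hb (by simpa [fullCount] using hbk))
      (C := 0) (by simp [fullCount]) (by simp)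
    have := hw.vNumber_le hI
    rw [degree_mkExp] at this
    simp [fullCount] at this
    obtain ⟨t, rfl⟩ := Nat.exists_eq_add_of_le' hk
    rw [Nat.add_sub_cancel] at this
    have e : (2 * b + 1) * (t + 1) = (2 * b + 1) * t + (2 * b + 1) := by ring
    omega

/-- Two affine functions of the same slope that agree for large `k` have the same constant, so no
other `c` can give an earlier start. -/
theorem vstab_eq_of_vNumber_pow {I : Ideal (MvPolynomial σ K)} (hb : 1 ≤ b) (c : ℤ)
    (h : ∀ k : ℕ, 1 ≤ k → ((vNumber (I ^ k) : ℤ) = (initialDegree I : ℤ) * k + c ↔ b ≤ k)) :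
    vstab I = b := by
  have hmem : ∀ k : ℕ, b ≤ k → (vNumber (I ^ k) : ℤ) = (initialDegree I : ℤ) * k + c :=
    fun k hk => (h k (by omega)).2 hk
  refine le_antisymm (Nat.sInf_le ⟨hb, c, hmem⟩) (le_csInf ⟨b, hb, c, hmem⟩ ?_)
  rintro k₀ ⟨hk₀, c', hc'⟩
  refine (h k₀ hk₀).1 ?_
  have h1 := hc' (k₀ + b) (by omega)
  have h2 := hmem (k₀ + b) (by omega)
  have h3 := hc' k₀ le_rfl
  have : c = c' := by linarith
  rw [h3, this]

theorem vstab_genIdeal [Finite σ] (hv : Function.Injective v) (hb : 1 ≤ b) :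
    vstab (genIdeal K b v) = b := by
  rcases Nat.eq_zero_or_pos n with hn | hn
  · refine vstab_eq_of_vNumber_pow hb (-1) fun k hk => ?_
    rw [← (vNumber_genIdeal_pow_of_eq_zero (K := K) hv hb hn hk).2, initialDegree_genIdeal hv hb,
      ← Nat.cast_inj (R := ℤ)]
    push_cast
    constructor <;> intro h <;> linarith
  -- The constant comes from `(2b+1)(k+1) - 2 = (2b+1)k + (2b-1)`.
  · refine vstab_eq_of_vNumber_pow hb (2 * b - 1) fun k hk => ?_
    rw [← (vNumber_genIdeal_pow (K := K) hv hb hn hk).2, initialDegree_genIdeal hv hb,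
      ← Nat.cast_inj (R := ℤ)]
    push_cast
    constructor <;> intro h <;> linarith

theorem exists_ideal_fin (K : Type*) [Field K] {a b : ℕ} (ha : 1 ≤ a) (hb : 1 ≤ b) :
    ∃ N : ℕ, 0 < N ∧ ∃ I : Ideal (MvPolynomial (Fin N) K),
      IsMonomialIdeal I ∧ I ≠ ⊥ ∧ I ≠ ⊤ ∧ (astab I, vstab I) = (a, b) := by
  have hv := (Fintype.equivFin (Gen (a - 1))).injective
  refine ⟨Fintype.card (Gen (a - 1)), Fintype.card_pos,
    genIdeal K b (Fintype.equivFin (Gen (a - 1))), isMonomialIdeal_span_range _, genIdeal_ne_bot,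
    genIdeal_ne_top hv hb, ?_⟩
  rw [astab_genIdeal hv hb, vstab_genIdeal hv hb, Nat.sub_add_cancel ha]

end Invariants

/-! ### Identification with the explicit ideal -/

section MainIdeal

/-- The variables of `mainIdeal K a b` in the order used by `genIdeal`. -/
def mainVars (a : ℕ) : Gen (a - 1) → Vars a
  | Sum.inl 0 => Sum.inl 0
  | Sum.inl 1 => Sum.inr 0
  | Sum.inl 2 => Sum.inr 1
  | Sum.inr (j, l) => Sum.inl ⟨3 * j + (l + 1), by omega⟩

theorem mainVars_injective (a : ℕ) : Function.Injective (mainVars a) := by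
  rintro (p | ⟨j, l⟩) (q | ⟨j', l'⟩) h
  · fin_cases p <;> fin_cases q <;> first | rfl | (simp [mainVars] at h)
  · match p, h with
    | 0, h =>
      have h' : 0 = 3 * (j' : ℕ) + (l' + 1) := congrArg Fin.val (Sum.inl.inj h)
      omega
    | 1, h => exact absurd h Sum.inr_ne_inl
    | 2, h => exact absurd h Sum.inr_ne_inl
  · match q, h with
    | 0, h =>
      have h' : 3 * (j : ℕ) + (l + 1) = 0 := congrArg Fin.val (Sum.inl.inj h)
      omega
    | 1, h => exact absurd h Sum.inl_ne_inr
    | 2, h => exact absurd h Sum.inl_ne_inr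
  · simp only [mainVars, Sum.inl.injEq, Fin.mk.injEq] at h
    have h1 : j = j' := by ext; omega
    have h2 : l = l' := by ext; omega
    rw [h1, h2]

theorem monomial_genExp_inr {n : ℕ} {σ K : Type*} [Field K] {b : ℕ} (v : Gen n → σ) (j : Fin n)
    (l : Fin 3) : monomial (genExp b v (Sum.inr (j, l))) (1 : K) =
      X (v (Sum.inl 0)) ^ (2 * b - 1) *
        (X (v (Sum.inr (j, l + 1))) * X (v (Sum.inr (j, l + 2)))) := by
  rw [X_pow_eq_monomial, X, X, monomial_mul, monomial_mul, one_mul, one_mul]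
  rfl

theorem mainIdeal_eq_genIdeal (K : Type*) [Field K] (a b : ℕ) :
    mainIdeal K a b = genIdeal K b (mainVars a) := by
  have hgen : ∀ i, monomial (genExp b (mainVars a) i) (1 : K) ∈ genIdeal K b (mainVars a) :=
    fun i => Ideal.subset_span ⟨i, rfl⟩
  have e1 : monomial (genExp b (mainVars a) (Sum.inl 0)) (1 : K) =
      X (Sum.inr 0) ^ (2 * b + 1) := by
    rw [X_pow_eq_monomial]
    rfl
  have e2 : monomial (genExp b (mainVars a) (Sum.inl 1)) (1 : K) =
      X (Sum.inr 0) ^ 2 * X (Sum.inr 1) ^ (2 * b - 1) := by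
    rw [X_pow_eq_monomial, X_pow_eq_monomial, monomial_mul, one_mul]
    rfl
  have e3 : monomial (genExp b (mainVars a) (Sum.inl 2)) (1 : K) =
      X (Sum.inr 1) ^ (2 * b + 1) := by
    rw [X_pow_eq_monomial]
    rfl
  have hQ : ∀ i : Fin 3, monomial (genExp b (mainVars a) (Sum.inl i)) (1 : K) ∈
      ({X (Sum.inr 0) ^ (2 * b + 1), X (Sum.inr 0) ^ 2 * X (Sum.inr 1) ^ (2 * b - 1),
        X (Sum.inr 1) ^ (2 * b + 1)} : Set (MvPolynomial (Vars a) K)) := by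
    intro i
    match i with
    | 0 => exact e1 ▸ Set.mem_insert _ _
    | 1 => exact e2 ▸ Set.mem_insert_of_mem _ (Set.mem_insert _ _)
    | 2 => exact e3 ▸ Set.mem_insert_of_mem _ (Set.mem_insert_of_mem _ (Set.mem_singleton _))
  have hedge : ∀ j l, (X (mainVars a (Sum.inr (j, l + 1))) * X (mainVars a (Sum.inr (j, l + 2))) :
      MvPolynomial (Vars a) K) ∈
      Submodule.colon (genIdeal K b (mainVars a)) {X (Sum.inl 0) ^ (2 * b - 1)} := by
    intro j l
    have := hgen (Sum.inr (j, l))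
    rw [monomial_genExp_inr, mul_comm] at this
    rwa [Submodule.mem_colon_singleton, smul_eq_mul]
  apply le_antisymm
  · refine sup_le (Ideal.span_singleton_mul_le_iff.2 ?_) (Ideal.span_le.2 ?_)
    · suffices h : ∑ i : Fin (a - 1), triangleIdeal K a i ≤
          Submodule.colon (genIdeal K b (mainVars a)) {X (Sum.inl 0) ^ (2 * b - 1)} by
        intro z hz
        have := h hz
        rwa [Submodule.mem_colon_singleton, smul_eq_mul, mul_comm] at this
      refine Finset.sum_induction _ (fun J => J ≤ _) (fun _ _ => sup_le) bot_le fun j _ => ?_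
      refine Ideal.span_le.2 ?_
      -- Edges are indexed by the opposite vertex, so `uv`, `uw`, `vw` correspond to `2`, `1`, `0`.
      rintro f (rfl | rfl | rfl)
      · exact hedge j 2
      · exact (mul_comm _ _).subst (motive := (· ∈ _)) (hedge j 1)
      · exact hedge j 0
    · rintro f (rfl | rfl | rfl)
      · exact e1 ▸ hgen _
      · exact e2 ▸ hgen _
      · exact e3 ▸ hgen _
  · refine Ideal.span_le.2 ?_
    rintro _ ⟨i | ⟨j, l⟩, rfl⟩
    · exact Ideal.mem_sup_right (Ideal.subset_span (hQ i))
    · refine Ideal.mem_sup_left ?_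
      dsimp only
      rw [monomial_genExp_inr]
      refine Ideal.mul_mem_mul (Ideal.mem_span_singleton_self _) ?_
      have hle : triangleIdeal K a j ≤ ∑ i : Fin (a - 1), triangleIdeal K a i :=
        Finset.single_le_sum (f := triangleIdeal K a) (fun _ _ => bot_le) (Finset.mem_univ j)
      refine hle (Ideal.subset_span ?_)
      match l with
      | 0 => exact Or.inr (Or.inr rfl)
      | 1 => exact Or.inr (Or.inl (mul_comm _ _))
      | 2 => exact Or.inl rfl

end MainIdeal

end StabilityIndices

theorem theorem2p1 (K : Type*) [Field K] :
    -- every pair of positive integers is attained by a (nonzero, proper) monomial ideal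
    (∀ a b : ℕ, 1 ≤ a → 1 ≤ b →
      ∃ N : ℕ, 0 < N ∧ ∃ I : Ideal (MvPolynomial (Fin N) K),
        StabilityIndices.IsMonomialIdeal I ∧ I ≠ ⊥ ∧ I ≠ ⊤ ∧
        (StabilityIndices.astab I, StabilityIndices.vstab I) = (a, b)) ∧
    -- for `a ≥ 2`, by an explicit ideal in `3(a+1)` variables
    (∀ a b : ℕ, 2 ≤ a → 1 ≤ b →
      Fintype.card (StabilityIndices.Vars a) = 3 * (a + 1) ∧
      StabilityIndices.IsMonomialIdeal (StabilityIndices.mainIdeal K a b) ∧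
      StabilityIndices.mainIdeal K a b ≠ ⊥ ∧ StabilityIndices.mainIdeal K a b ≠ ⊤ ∧
      (StabilityIndices.astab (StabilityIndices.mainIdeal K a b),
        StabilityIndices.vstab (StabilityIndices.mainIdeal K a b)) = (a, b)) ∧
    -- neither index bounds the other in general
    (∃ N : ℕ, 0 < N ∧ ∃ I : Ideal (MvPolynomial (Fin N) K),
      StabilityIndices.IsMonomialIdeal I ∧ I ≠ ⊥ ∧ I ≠ ⊤ ∧
      1 ≤ StabilityIndices.astab I ∧ StabilityIndices.astab I < StabilityIndices.vstab I) ∧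
    (∃ N : ℕ, 0 < N ∧ ∃ I : Ideal (MvPolynomial (Fin N) K),
      StabilityIndices.IsMonomialIdeal I ∧ I ≠ ⊥ ∧ I ≠ ⊤ ∧
      1 ≤ StabilityIndices.vstab I ∧ StabilityIndices.vstab I < StabilityIndices.astab I) := by
  refine ⟨fun a b ha hb => StabilityIndices.exists_ideal_fin K ha hb, fun a b ha hb => ?_, ?_, ?_⟩
  · have hv := StabilityIndices.mainVars_injective a
    rw [StabilityIndices.mainIdeal_eq_genIdeal, StabilityIndices.astab_genIdeal hv hb,
      StabilityIndices.vstab_genIdeal hv hb, Nat.sub_add_cancel (by omega)]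
    refine ⟨?_, StabilityIndices.isMonomialIdeal_span_range _, StabilityIndices.genIdeal_ne_bot,
      StabilityIndices.genIdeal_ne_top hv hb, rfl⟩
    rw [Fintype.card_sum, Fintype.card_fin, Fintype.card_fin]
    omega
  · obtain ⟨N, hN, I, hI, h1, h2, h3⟩ :=
      StabilityIndices.exists_ideal_fin K (a := 1) (b := 2) le_rfl (by omega)
    obtain ⟨h4, h5⟩ := Prod.mk.inj h3
    exact ⟨N, hN, I, hI, h1, h2, by omega, by omega⟩
  · obtain ⟨N, hN, I, hI, h1, h2, h3⟩ :=
      StabilityIndices.exists_ideal_fin K (a := 2) (b := 1) (by omega) le_rfl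
    obtain ⟨h4, h5⟩ := Prod.mk.inj h3
    exact ⟨N, hN, I, hI, h1, h2, by omega, by omega⟩
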